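/- Let $\mathbb{R}_+$ be the poset $[0,\infty)$. A persistent object in a category $\mathcal C$ is a functor $\mathbb{X}:\mathbb{R}_+\to\mathcal C$. It is \emph{tame} if there are finitely many $t_0<\dots<t_n$ in $[0,\infty)$ such that a structure map $\mathbb{X}(a)\to\mathbb{X}(b)$, $a<b$, can fail to be an isomorphism only if $a<t_i\le b$ for some $i$. A persistent cochain complex is a persistent object in non-negatively graded cochain complexes over $\mathbb{Q}$; $\mathbb{X}^k$ and $Z\mathbb{X}^k$ denote its persistence modules of $k$-cochains and $k$-cocycles. For $0\le s<t\le\infty$ let $\mathbb{I}_{[s,t)}$ be the interval module, equal to $\mathbb{Q}$ on $[s,t)$ with identity structure maps and $0$ elsewhere. Let $S^k$ be the complex $\mathbb{Q}$ in degree $k$, and $D^k$ the complex $\mathbb{Q}\xrightarrow{=}\mathbb{Q}$ in degrees $k-1,k$, with $D^0=0$. For $k\ge 0$ the persistent disk $\mathbb{D}^k_s$ is $D^k$ at times $\ge s$ and $0$ before; the interval sphere $\mathbb{S}^k_{[s,t)}$ is $0$ before $s$, $S^k$ on $[s,t)$ and $D^k$ from $t$ on; the structure maps are the natural ones, and there is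 a natural map $\mathbb{S}^k_{[s,t)}\to\mathbb{D}^k_s$. The \emph{interval-sphere model structure} on persistent cochain complexes has the pointwise quasi-isomorphisms as weak equivalences, generating cofibrations $\mathbb{S}^k_{[s,t)}\to\mathbb{D}^k_s$ ($k\ge0$, $0\le s<t\le\infty$), and generating trivial cofibrations $\mathbb{D}^k_t\to\mathbb{D}^k_s$ and $0\to\mathbb{D}^k_s$ ($k\ge0$, $0\le s<t<\infty$). Thus its cofibrations are the maps with the left lifting property against every map that has the right lifting property against the generating cofibrations. \textbf{Statement.} Let $i:\mathbb{X}\to\mathbb{Y}$ be a (pointwise, degreewise) injective map of tame persistent cochain complexes. Then $i$ is a cofibration in the interval-sphere model structure. Moreover, let $\mathbb{W}=i(\mathbb{X})+Z\mathbb{Y}\subseteq\mathbb{Y}$. Then $i$ is the composite $\mathbb{X}\to\mathbb{W}\hookrightarrow\mathbb{Y}$ of two cell attachments, as follows. (1) For each $k\ge0$ there are a set $\Gamma_k$, intervals $[s_\gamma,t_\gamma)$ with $0\le s_\gamma<t_\gamma\le\infty$, and cocycles $z_\gamma\in Z\mathbb{Y}^k(s_\gamma)$, $\gamma\in\Gamma_k$,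 whose classes are the generators of the summands in an interval decomposition $Z\mathbb{Y}^k/i(Z\mathbb{X}^k)\cong\bigoplus_{\gamma\in\Gamma_k}\mathbb{I}_{[s_\gamma,t_\gamma)}$; and there is a pushout square $$\begin{array}{ccc}\bigoplus_{k}\bigoplus_{\gamma\in\Gamma_k}\mathbb{S}^{k+1}_{[s_\gamma,t_\gamma)}&\to&\mathbb{X}\\ \downarrow&&\downarrow\\ \bigoplus_{k}\bigoplus_{\gamma\in\Gamma_k}\mathbb{D}^{k+1}_{s_\gamma}&\to&\mathbb{W}\end{array}$$ whose left map is the sum of the natural maps, whose right map is induced by $i$, and whose bottom map sends the degree $k$ generator of the summand $\gamma$ (at time $s_\gamma$) to $z_\gamma$. (2) For each $k\ge0$ there are a set $\Delta_k$, intervals $[s_\delta,t_\delta)$ with $0\le s_\delta<t_\delta\le\infty$, and elements $y_\delta\in\mathbb{Y}^k(s_\delta)$, $\delta\in\Delta_k$, whose classes are the generators of the summands in an interval decomposition $\mathbb{Y}^k/\mathbb{W}^k\cong\bigoplus_{\delta\in\Delta_k}\mathbb{I}_{[s_\delta,t_\delta)}$; and there is a pushout square as in (1), with $\Delta_k$,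 $\mathbb{W}\hookrightarrow\mathbb{Y}$ and $y_\delta$ in place of $\Gamma_k$, $\mathbb{X}\to\mathbb{W}$ and $z_\gamma$. In particular, every tame persistent cochain complex is cofibrant in the interval-sphere model structure. (All this holds in particular for tame connected objects.) -/

import Mathlib

open CategoryTheory CategoryTheory.Limits HomotopicalAlgebra
open scoped NNReal

noncomputable section

namespace PersistentComplex

/-- Persistent objects in `C`: functors from the poset `[0, ∞)` to `C`. -/
abbrev Persistent (C : Type*) [Category* C] := ℝ≥0 ⥤ C

/-- Persistence modules over `ℚ`. -/
abbrev PVec := Persistent (ModuleCat.{0} ℚ)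

/-- Persistent (non-negatively graded) cochain complexes over `ℚ`. -/
abbrev PCh := Persistent (CochainComplex (ModuleCat.{0} ℚ) ℕ)

/-! ### Tameness and injectivity -/

/-- The sequence `t 0 < ⋯ < t n` discretizes `X`: a structure map `X(a < b)` may fail to be an
isomorphism only if `a < t i ≤ b` for some `i`. -/
def Discretizes {C : Type*} [Category* C] (X : Persistent C) {n : ℕ} (t : Fin (n + 1) → ℝ≥0) :
    Prop :=
  ∀ (a b : ℝ≥0) (h : a < b), ¬ IsIso (X.map (homOfLE h.le)) → ∃ i, a < t i ∧ t i ≤ b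

/-- A persistent object is tame if it admits a discretization. -/
def IsTame {C : Type*} [Category* C] (X : Persistent C) : Prop :=
  ∃ (n : ℕ) (t : Fin (n + 1) → ℝ≥0), StrictMono t ∧ Discretizes X t

/-- Injective maps of persistent complexes: injective at every time, in every degree. -/
def IsInjective {X Y : PCh} (i : X ⟶ Y) : Prop :=
  ∀ (r : ℝ≥0) (k : ℕ), Function.Injective ((i.app r).f k)

/-! ### Copies of `ℚ` supported on a proposition -/

/-- The vector space which is `ℚ` if `P` holds, and `0` otherwise. -/
abbrev QIf (P : Prop) : ModuleCat.{0} ℚ := ModuleCat.of ℚ (PLift P → ℚ)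

/-- The generator `1` of `QIf P` (which is `0` if `P` fails). -/
def QIf.one (P : Prop) : QIf P := (fun _ => 1 : PLift P → ℚ)

open Classical in
/-- The linear map underlying `QIf.map`. -/
def QIf.linearMap (P Q : Prop) : (PLift P → ℚ) →ₗ[ℚ] (PLift Q → ℚ) where
  toFun f _ := if h : P then f ⟨h⟩ else 0
  map_add' f g := by funext q; by_cases h : P <;> simp [h]
  map_smul' c f := by funext q; by_cases h : P <;> simp [h]

/-- The map `QIf P ⟶ QIf Q` which is the identity of `ℚ` if `P` and `Q` hold, and `0`
otherwise. -/
def QIf.map (P Q : Prop) : QIf P ⟶ QIf Q := ModuleCat.ofHom (QIf.linearMap P Q)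

theorem QIf.linearMap_of {P : Prop} (Q : Prop) (h : P) (f : PLift P → ℚ) (q : PLift Q) :
    QIf.linearMap P Q f q = f ⟨h⟩ := dif_pos h

theorem QIf.linearMap_of_not {P : Prop} (Q : Prop) (h : ¬ P) (f : PLift P → ℚ) (q : PLift Q) :
    QIf.linearMap P Q f q = 0 := dif_neg h

theorem QIf.map_self (P : Prop) : QIf.map P P = 𝟙 (QIf P) := by
  apply ModuleCat.hom_ext
  apply LinearMap.ext
  intro f
  funext q
  exact QIf.linearMap_of P q.down f q

theorem QIf.map_comp (P Q R : Prop) (h : P → R → Q) :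
    QIf.map P Q ≫ QIf.map Q R = QIf.map P R := by
  apply ModuleCat.hom_ext
  apply LinearMap.ext
  intro f
  funext r
  change QIf.linearMap Q R (QIf.linearMap P Q f) r = QIf.linearMap P R f r
  by_cases hP : P
  · rw [QIf.linearMap_of R (h hP r.down), QIf.linearMap_of Q hP, QIf.linearMap_of R hP]
  · rw [QIf.linearMap_of_not R hP]
    by_cases hQ : Q
    · rw [QIf.linearMap_of R hQ, QIf.linearMap_of_not Q hP]
    · rw [QIf.linearMap_of_not R hQ]

theorem QIf.map_eq_zero (P Q : Prop) (h : P → ¬ Q) : QIf.map P Q = 0 := by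
  apply ModuleCat.hom_ext
  apply LinearMap.ext
  intro f
  funext q
  exact QIf.linearMap_of_not Q (fun hP => h hP q.down) f q

theorem QIf.comp_eq_zero (P Q R : Prop) (h : P → ¬ R) :
    QIf.map P Q ≫ QIf.map Q R = 0 := by
  by_cases hQ : P → ¬ Q
  · rw [QIf.map_eq_zero P Q hQ, zero_comp]
  · rw [QIf.map_comp P Q R (fun hP hR => absurd hR (h hP)), QIf.map_eq_zero P R h]

/-! ### Interval modules, interval spheres and persistent disks -/

/-- The interval module of `[s, t)`, where `t` may be `⊤`. -/
def intervalModule (s : ℝ≥0) (t : WithTop ℝ≥0) : PVec where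
  obj r := QIf (s ≤ r ∧ (r : WithTop ℝ≥0) < t)
  map _ := QIf.map _ _
  map_id _ := QIf.map_self _
  map_comp {_ _ _} f g := (QIf.map_comp _ _ _ fun h h' =>
    ⟨h.1.trans (leOfHom f), lt_of_le_of_lt (WithTop.coe_le_coe.2 (leOfHom g)) h'.2⟩).symm

/-- The generator of the interval module of `[s, t)`, at time `s`. -/
def intervalModule.gen (s : ℝ≥0) (t : WithTop ℝ≥0) : (intervalModule s t).obj s := QIf.one _

/-- A persistent complex consisting of copies of `ℚ` at those times `r` and degrees `j` for which
`P r j` holds, all differentials and structure maps between them being identities. The hypotheses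
are what is needed for this to be a persistent complex. -/
def ofSupport (P : ℝ≥0 → ℕ → Prop)
    (hd : ∀ r j, P r j → ¬ P r (j + 1 + 1))
    (hP : ∀ j r₁ r₂ r₃, r₁ ≤ r₂ → r₂ ≤ r₃ → P r₁ j → P r₃ j → P r₂ j)
    (hc : ∀ j r₁ r₂, r₁ ≤ r₂ → P r₁ j → P r₂ (j + 1) → (P r₂ j ↔ P r₁ (j + 1))) : PCh where
  obj r :=
    { X := fun j => QIf (P r j)
      d := fun i j => if i + 1 = j then QIf.map (P r i) (P r j) else 0
      shape := fun i j h => if_neg h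
      d_comp_d' := by
        rintro i _ _ rfl rfl
        simp only [if_true]
        exact QIf.comp_eq_zero _ _ _ (hd r i) }
  map {r r'} φ :=
    { f := fun j => QIf.map (P r j) (P r' j)
      comm' := by
        rintro i _ rfl
        simp only [if_true]
        by_cases h : P r i ∧ P r' (i + 1)
        · have := hc i r r' (leOfHom φ) h.1 h.2
          by_cases h' : P r' i
          · rw [QIf.map_comp _ _ _ fun _ _ => h', QIf.map_comp _ _ _ fun _ _ => this.1 h']
          · rw [QIf.map_eq_zero (P r i) (P r' i) fun _ => h', zero_comp,
              QIf.map_eq_zero (P r i) (P r (i + 1)) fun _ h'' => h' (this.2 h''), zero_comp]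
        · rw [QIf.comp_eq_zero _ _ _ fun a b => h ⟨a, b⟩,
            QIf.comp_eq_zero _ _ _ fun a b => h ⟨a, b⟩] }
  map_id r := by
    ext1 j
    exact QIf.map_self _
  map_comp {r₁ r₂ r₃} f g := by
    ext1 j
    exact (QIf.map_comp _ _ _ (hP j r₁ r₂ r₃ (leOfHom f) (leOfHom g))).symm

/-- The support of the interval sphere of degree `k` on `[s, t)`: it is the sphere complex `S^k`
at times `s ≤ r < t` and the disk complex `D^k` (a copy of `ℚ` in degrees `k - 1` and `k`) at
times `r ≥ t`, where `D^0 = 0`. -/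
def sphereSupport (k : ℕ) (s : ℝ≥0) (t : WithTop ℝ≥0) (r : ℝ≥0) (j : ℕ) : Prop :=
  s ≤ r ∧ (((r : WithTop ℝ≥0) < t ∧ j = k) ∨
    (t ≤ (r : WithTop ℝ≥0) ∧ k ≠ 0 ∧ (j = k ∨ j + 1 = k)))

/-- The support of the persistent disk of degree `k` at `s`: it is `0` at times `r < s` and
`D^k` at times `r ≥ s`. -/
def diskSupport (k : ℕ) (s : ℝ≥0) (r : ℝ≥0) (j : ℕ) : Prop :=
  s ≤ r ∧ k ≠ 0 ∧ (j = k ∨ j + 1 = k)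

/-- The interval sphere of degree `k` on `[s, t)`: the left Kan extension of `S^k ↪ D^k` along
`{s < t} ⊆ [0, ∞)`. It is meant for `s ≤ t`, where `t` may be `⊤`. -/
def intervalSphere (k : ℕ) (s : ℝ≥0) (t : WithTop ℝ≥0) : PCh :=
  ofSupport (sphereSupport k s t)
    (by
      rintro r j ⟨-, ⟨-, h⟩ | ⟨-, -, h⟩⟩ ⟨-, ⟨-, h'⟩ | ⟨-, -, h'⟩⟩ <;> omega)
    (by
      rintro j r₁ r₂ r₃ h₁₂ h₂₃ ⟨hs, h⟩ ⟨-, h'⟩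
      refine ⟨hs.trans h₁₂, ?_⟩
      by_cases ht : (r₂ : WithTop ℝ≥0) < t
      · have : (r₁ : WithTop ℝ≥0) < t := lt_of_le_of_lt (WithTop.coe_le_coe.2 h₁₂) ht
        exact Or.inl ⟨ht, h.elim (fun a => a.2) fun a => absurd this (not_lt.2 a.1)⟩
      · have : ¬ (r₃ : WithTop ℝ≥0) < t := fun a =>
          ht (lt_of_le_of_lt (WithTop.coe_le_coe.2 h₂₃) a)
        exact Or.inr ⟨not_lt.1 ht, h'.elim (fun a => absurd a.1 this) fun a => a.2⟩)
    (by
      rintro j r₁ r₂ h₁₂ ⟨hs, h⟩ ⟨-, h'⟩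
      have hmono : t ≤ (r₁ : WithTop ℝ≥0) → t ≤ (r₂ : WithTop ℝ≥0) := fun a =>
        a.trans (WithTop.coe_le_coe.2 h₁₂)
      rcases h with ⟨h1, h2⟩ | ⟨h1, h2, h3⟩
      · rcases h' with ⟨h4, h5⟩ | ⟨h4, h5, h6⟩ <;> omega
      · have hk : j + 1 = k := by rcases h' with ⟨h4, h5⟩ | ⟨h4, h5, h6⟩ <;> omega
        exact iff_of_true ⟨hs.trans h₁₂, Or.inr ⟨hmono h1, h2, Or.inr hk⟩⟩
          ⟨hs, Or.inr ⟨h1, h2, Or.inl hk⟩⟩)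

/-- The persistent disk of degree `k` at `s`: the left Kan extension of `D^k` along
`{s} ⊆ [0, ∞)`. It vanishes for `k = 0`. -/
def persistentDisk (k : ℕ) (s : ℝ≥0) : PCh :=
  ofSupport (diskSupport k s)
    (by
      rintro r j ⟨-, -, h⟩ ⟨-, -, h'⟩
      omega)
    (by
      rintro j r₁ r₂ r₃ h₁₂ - ⟨hs, h⟩ -
      exact ⟨hs.trans h₁₂, h⟩)
    (by
      rintro j r₁ r₂ h₁₂ ⟨hs, hk, h⟩ ⟨-, -, h'⟩
      have hk' : j + 1 = k := by omega
      exact iff_of_true ⟨hs.trans h₁₂, hk, Or.inr hk'⟩ ⟨hs, hk, Or.inl hk'⟩)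

/-- The generator of the persistent disk `D_s^{k + 1}`: the element `1` of degree `k` at time
`s`. -/
def persistentDisk.gen (k : ℕ) (s : ℝ≥0) : ((persistentDisk (k + 1) s).obj s).X k := QIf.one _

/-- The natural map from the interval sphere of degree `k` on `[s, t)` to the persistent disk of
degree `k` at `s`: the identity of `ℚ` wherever both are nonzero. -/
def sphereToDisk (k : ℕ) (s : ℝ≥0) (t : WithTop ℝ≥0) :
    intervalSphere k s t ⟶ persistentDisk k s where
  app r :=
    { f := fun j => QIf.map (sphereSupport k s t r j) (diskSupport k s r j)
      comm' := by
        rintro i _ rfl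
        change QIf.map (sphereSupport k s t r i) (diskSupport k s r i) ≫
            (if i + 1 = i + 1 then QIf.map _ _ else 0) =
          (if i + 1 = i + 1 then QIf.map _ _ else 0) ≫
            QIf.map (sphereSupport k s t r (i + 1)) (diskSupport k s r (i + 1))
        rw [if_pos rfl, if_pos rfl]
        by_cases h : sphereSupport k s t r i ∧ diskSupport k s r (i + 1)
        · obtain ⟨⟨hs, h1⟩, -, hk, h2⟩ := h
          have hi : i + 1 = k := by rcases h1 with ⟨a, b⟩ | ⟨a, b, c⟩ <;> omega
          have ht : t ≤ (r : WithTop ℝ≥0) := by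
            rcases h1 with ⟨a, b⟩ | ⟨a, b, c⟩
            · omega
            · exact a
          rw [QIf.map_comp _ _ _ fun _ _ => ⟨hs, hk, Or.inr hi⟩,
            QIf.map_comp _ _ _ fun _ _ => ⟨hs, Or.inr ⟨ht, hk, Or.inl hi⟩⟩]
        · rw [QIf.comp_eq_zero _ _ _ fun a b => h ⟨a, b⟩,
            QIf.comp_eq_zero _ _ _ fun a b => h ⟨a, b⟩] }
  naturality r r' φ := by
    ext1 j
    change QIf.map (sphereSupport k s t r j) (sphereSupport k s t r' j) ≫
        QIf.map (sphereSupport k s t r' j) (diskSupport k s r' j) =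
      QIf.map (sphereSupport k s t r j) (diskSupport k s r j) ≫
        QIf.map (diskSupport k s r j) (diskSupport k s r' j)
    have hr := leOfHom φ
    rw [QIf.map_comp _ _ _ ?_, QIf.map_comp _ _ _ ?_]
    · rintro ⟨hs, -⟩ ⟨-, h⟩
      exact ⟨hs, h⟩
    · rintro ⟨hs, h⟩ ⟨-, hk, h'⟩
      refine ⟨hs.trans hr, ?_⟩
      by_cases ht : (r' : WithTop ℝ≥0) < t
      · have : (r : WithTop ℝ≥0) < t := lt_of_le_of_lt (WithTop.coe_le_coe.2 hr) ht
        exact Or.inl ⟨ht, h.elim (fun a => a.2) fun a => absurd this (not_lt.2 a.1)⟩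
      · exact Or.inr ⟨not_lt.1 ht, hk, h'⟩

/-- The natural map `D_t^k ⟶ D_s^k` for `s ≤ t`. -/
def diskToDisk (k : ℕ) {s t : ℝ≥0} (hst : s ≤ t) : persistentDisk k t ⟶ persistentDisk k s where
  app r :=
    { f := fun j => QIf.map (diskSupport k t r j) (diskSupport k s r j)
      comm' := by
        rintro i _ rfl
        change QIf.map (diskSupport k t r i) (diskSupport k s r i) ≫
            (if i + 1 = i + 1 then QIf.map _ _ else 0) =
          (if i + 1 = i + 1 then QIf.map _ _ else 0) ≫
            QIf.map (diskSupport k t r (i + 1)) (diskSupport k s r (i + 1))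
        rw [if_pos rfl, if_pos rfl, QIf.map_comp _ _ _ ?_, QIf.map_comp _ _ _ ?_]
        · rintro ⟨ht, hk, -⟩ ⟨-, -, h⟩
          exact ⟨ht, hk, h⟩
        · rintro ⟨ht, hk, h⟩ -
          exact ⟨hst.trans ht, hk, h⟩ }
  naturality r r' φ := by
    ext1 j
    change QIf.map (diskSupport k t r j) (diskSupport k t r' j) ≫
        QIf.map (diskSupport k t r' j) (diskSupport k s r' j) =
      QIf.map (diskSupport k t r j) (diskSupport k s r j) ≫
        QIf.map (diskSupport k s r j) (diskSupport k s r' j)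
    rw [QIf.map_comp _ _ _ ?_, QIf.map_comp _ _ _ ?_]
    · rintro ⟨ht, h⟩ -
      exact ⟨hst.trans ht, h⟩
    · rintro ⟨ht, h⟩ -
      exact ⟨ht.trans (leOfHom φ), h⟩

/-! ### The interval-sphere model structure -/

/-- The generating cofibrations: the maps from the interval sphere on `[s, t)` to the persistent
disk at `s`, for `0 ≤ s < t ≤ ∞` and all degrees `k ≥ 0`. -/
inductive generatingCofibrations : MorphismProperty PCh
  | sphereToDisk (k : ℕ) (s : ℝ≥0) (t : WithTop ℝ≥0) (h : (s : WithTop ℝ≥0) < t) :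
      generatingCofibrations (sphereToDisk k s t)

/-- The generating trivial cofibrations: the maps `D_t^k ⟶ D_s^k` for `0 ≤ s < t < ∞`, and the
maps `0 ⟶ D_s^k` for `0 ≤ s < ∞`, for all degrees `k ≥ 0`. -/
inductive generatingTrivialCofibrations : MorphismProperty PCh
  | diskToDisk (k : ℕ) (s t : ℝ≥0) (h : s < t) :
      generatingTrivialCofibrations (diskToDisk k h.le)
  | zeroToDisk (k : ℕ) (s : ℝ≥0) :
      generatingTrivialCofibrations (initial.to (persistentDisk k s))

/-- The cofibrations of the interval-sphere model structure: the maps with the left lifting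
property against all maps that have the right lifting property against the generating
cofibrations. -/
instance : CategoryWithCofibrations PCh where
  cofibrations := generatingCofibrations.rlp.llp

/-- The fibrations of the interval-sphere model structure: the maps with the right lifting
property against the generating trivial cofibrations. -/
instance : CategoryWithFibrations PCh where
  fibrations := generatingTrivialCofibrations.rlp

/-- The weak equivalences of the interval-sphere model structure: the pointwise
quasi-isomorphisms. -/
instance : CategoryWithWeakEquivalences PCh where
  weakEquivalences := fun _ _ f => ∀ r : ℝ≥0, QuasiIso (f.app r)

/-! ### Interval decompositions and cell attachments -/

/-- The persistence module of `k`-cochains. -/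
abbrev cochains (k : ℕ) : PCh ⥤ PVec :=
  (Functor.whiskeringRight _ _ _).obj (HomologicalComplex.eval (ModuleCat.{0} ℚ) _ k)

/-- The persistence module of `k`-cocycles. -/
abbrev cocycles (k : ℕ) : PCh ⥤ PVec :=
  (Functor.whiskeringRight _ _ _).obj (HomologicalComplex.cyclesFunctor (ModuleCat.{0} ℚ) _ k)

/-- The elements `v γ` of `V` at the times `s γ` generate a decomposition of the persistence
module `V` as the direct sum of the interval modules of `[s γ, t γ)`: there is an isomorphism from
that direct sum to `V` which takes the generator of the summand `γ` to `v γ`. -/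
def IsIntervalDecomposition {Γ : Type} (s : Γ → ℝ≥0) (t : Γ → WithTop ℝ≥0) (V : PVec)
    (v : ∀ γ, V.obj (s γ)) : Prop :=
  (∀ γ, (s γ : WithTop ℝ≥0) < t γ) ∧
  ∃ e : (∐ fun γ => intervalModule (s γ) (t γ)) ≅ V,
    ∀ γ, (Sigma.ι (fun γ => intervalModule (s γ) (t γ)) γ ≫ e.hom).app (s γ)
      (intervalModule.gen (s γ) (t γ)) = v γ

/-- The map `f : A ⟶ B` attaches to `A` simultaneously, for every `k` and every `γ : Γ k`, a cell
`D_s^{k + 1}` along the interval sphere of degree `k + 1` on `[s, t)`, where `s = s k γ` and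
`t = t k γ`, and `b k γ`, of degree `k` and at time `s`, is the element of `B` defined by that
cell. -/
def IsCellAttachment {Γ : ℕ → Type} (s : ∀ k, Γ k → ℝ≥0) (t : ∀ k, Γ k → WithTop ℝ≥0)
    {A B : PCh} (f : A ⟶ B) (b : ∀ k (γ : Γ k), (B.obj (s k γ)).X k) : Prop :=
  ∃ (φ : (∐ fun γ : Σ k, Γ k => intervalSphere (γ.1 + 1) (s γ.1 γ.2) (t γ.1 γ.2)) ⟶ A)
    (ψ : (∐ fun γ : Σ k, Γ k => persistentDisk (γ.1 + 1) (s γ.1 γ.2)) ⟶ B),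
    IsPushout φ (Limits.Sigma.map fun γ => sphereToDisk (γ.1 + 1) (s γ.1 γ.2) (t γ.1 γ.2)) f ψ ∧
    ∀ (k : ℕ) (γ : Γ k),
      ((Sigma.ι (fun γ : Σ k, Γ k => persistentDisk (γ.1 + 1) (s γ.1 γ.2)) ⟨k, γ⟩ ≫ ψ).app
        (s k γ)).f k (persistentDisk.gen k (s k γ)) = b k γ

/-- The injective map `j : W ⟶ Y` identifies `W` with the subcomplex `i(X) + ZY` of `Y`. -/
def IsImageAddCocycles {X W Y : PCh} (i : X ⟶ Y) (j : W ⟶ Y) : Prop :=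
  IsInjective j ∧
  ∀ (r : ℝ≥0) (k : ℕ), LinearMap.range ((j.app r).f k).hom =
    LinearMap.range ((i.app r).f k).hom ⊔ LinearMap.ker ((Y.obj r).d k (k + 1)).hom

/-- The map `i : X ⟶ Y` factors as `X ⟶ W ⟶ Y`, where `W` is the subcomplex `i(X) + ZY` of `Y`
and where

* `X ⟶ W` attaches cells along cocycles `z k γ` of `Y` whose classes generate an interval
  decomposition of the graded persistence module `ZY / i(ZX)`;
* `W ⟶ Y` attaches cells along elements `y k δ` of `Y` whose classes generate an interval
  decomposition of the graded persistence module `Y / (i(X) + ZY)`. -/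
def IsTwoStepCellAttachment {X Y : PCh} (i : X ⟶ Y) : Prop :=
  ∃ (W : PCh) (a : X ⟶ W) (j : W ⟶ Y), a ≫ j = i ∧ IsImageAddCocycles i j ∧
    (∃ (Γ : ℕ → Type) (s : ∀ k, Γ k → ℝ≥0) (t : ∀ k, Γ k → WithTop ℝ≥0)
      (z : ∀ k (γ : Γ k), ((cocycles k).obj Y).obj (s k γ))
      (w : ∀ k (γ : Γ k), (W.obj (s k γ)).X k),
      (∀ k (γ : Γ k), (j.app (s k γ)).f k (w k γ) = (Y.obj (s k γ)).iCycles k (z k γ)) ∧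
      (∀ k, IsIntervalDecomposition (s k) (t k) (cokernel ((cocycles k).map i))
        fun γ => (cokernel.π ((cocycles k).map i)).app (s k γ) (z k γ)) ∧
      IsCellAttachment s t a w) ∧
    (∃ (Δ : ℕ → Type) (s : ∀ k, Δ k → ℝ≥0) (t : ∀ k, Δ k → WithTop ℝ≥0)
      (y : ∀ k (δ : Δ k), (Y.obj (s k δ)).X k),
      (∀ k, IsIntervalDecomposition (s k) (t k) (cokernel ((cochains k).map j))
        fun δ => (cokernel.π ((cochains k).map j)).app (s k δ) (y k δ)) ∧
      IsCellAttachment s t j y)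

end PersistentComplex

end

/-!
A tame persistence module has a basis of bars. The subspaces of its first nonzero stage which die
at the finitely many later jumps form a chain, so this stage has a basis adapted to that chain, and
each basis vector spans a bar. These bars span the submodule generated by the first stage; the
quotient by that submodule has one jump less, and a bar of the quotient lifts to a bar of the
module, because the structure maps of the submodule are surjective from the first stage on.

The quotient of `D_s^{k+1}` by the image of `S_{[s,t)}^{k+1}` is the interval module of `[s,t)`,
placed in degree `k`. Hence an injective map is an attachment of cells as soon as its cokernel has
zero differential on the generators of an interval decomposition in each degree: the attaching maps
exist because the boundaries of the cells die in the cokernel, and the square is a pushout because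
it induces an isomorphism of the cokernels of its vertical maps. For `W = i(X) + ZY` both cokernels
have zero differential: `W / i(X)` is `ZY / i(ZX)`, and in `Y / W` all coboundaries vanish, being
cocycles.
-/

noncomputable section

namespace PersistentComplex

/-! ### Bases adapted to chains of subspaces -/

section AdaptedBases

theorem exists_linearIndepOn_adapted {K E ι : Type*} [DivisionRing K] [AddCommGroup E]
    [Module K E] [LinearOrder ι] {U : ι → Submodule K E} (hU : Monotone U) (C : Finset ι) :
    ∃ B : Set E, LinearIndepOn K id B ∧ (∀ v ∈ B, ∃ c ∈ C, v ∈ U c) ∧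
      ∀ c ∈ C, U c ≤ Submodule.span K (B ∩ U c) := by
  induction C using Finset.induction_on_max with
  | empty => exact ⟨∅, linearIndepOn_empty _ _, by simp, by simp⟩
  | insert a C ha ih =>
    obtain ⟨B, hB, hBC, hspan⟩ := ih
    have hBa : B ⊆ U a := fun v hv => by
      obtain ⟨c, hc, hvc⟩ := hBC v hv
      exact hU (ha c hc).le hvc
    obtain ⟨B', hB'a, hBB', hspan', hB'⟩ := exists_linearIndepOn_id_extension hB hBa
    refine ⟨B', hB', fun v hv => ⟨a, by simp, hB'a hv⟩, fun c hc => ?_⟩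
    rcases Finset.mem_insert.1 hc with rfl | hc
    · rwa [Set.inter_eq_self_of_subset_left hB'a]
    · exact (hspan c hc).trans (Submodule.span_mono (Set.inter_subset_inter_left _ hBB'))

theorem exists_basis_adapted {K E ι : Type*} [DivisionRing K] [AddCommGroup E] [Module K E]
    [LinearOrder ι] {U : ι → Submodule K E} (hU : Monotone U) (C : Finset ι) :
    ∃ B : Set E, LinearIndepOn K id B ∧ Submodule.span K B = ⊤ ∧
      ∀ c ∈ C, U c ≤ Submodule.span K (B ∩ U c) := by
  obtain ⟨B, hB, -, hspan⟩ := exists_linearIndepOn_adapted hU C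
  obtain ⟨B', -, hBB', htop, hB'⟩ := exists_linearIndepOn_id_extension hB (Set.subset_univ _)
  exact ⟨B', hB', top_unique fun x _ => htop (Set.mem_univ x), fun c hc =>
    (hspan c hc).trans (Submodule.span_mono (Set.inter_subset_inter_left _ hBB'))⟩

variable {R M N : Type*} [Ring R] [AddCommGroup M] [Module R M] [AddCommGroup N] [Module R N]

theorem linearIndepOn_diff_ker {B : Set M} (hB : LinearIndepOn R id B)
    {f : M →ₗ[R] N} (hf : LinearMap.ker f ≤ Submodule.span R (B ∩ LinearMap.ker f)) :
    LinearIndepOn R f (B \ LinearMap.ker f) := by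
  have hsplit : LinearIndepOn R id (B \ LinearMap.ker f ∪ B ∩ LinearMap.ker f) := by
    rwa [Set.sdiff_union_inter]
  obtain ⟨hind, -, hdisj⟩ := (linearIndepOn_id_union_iff Set.disjoint_sdiff_inter).1 hsplit
  refine hind.map_injOn f (LinearMap.injOn_of_disjoint_ker le_rfl ?_)
  rw [Set.image_id]
  exact hdisj.mono_right hf

theorem span_image_diff_ker (B : Set M) (f : M →ₗ[R] N) :
    Submodule.span R (f '' (B \ LinearMap.ker f)) = (Submodule.span R B).map f := by
  rw [Submodule.map_span]
  refine le_antisymm (Submodule.span_mono (Set.image_mono Set.sdiff_subset))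
    (Submodule.span_le.2 ?_)
  rintro _ ⟨v, hv, rfl⟩
  by_cases hvf : f v = 0
  · rw [hvf]
    exact Submodule.zero_mem _
  · exact Submodule.subset_span ⟨v, ⟨hv, hvf⟩, rfl⟩

end AdaptedBases

/-! ### Functors with finitely many jumps -/

section Jumps

variable {ι : Type*} [LinearOrder ι] {C : Type*} [Category* C]

/-- The structure map `X a ⟶ X b` is an isomorphism unless some time of `T` lies in `(a, b]`. For
persistent objects this is tameness with a prescribed set of times, see `isTame_iff`; unlike in
`Discretizes`, the set `T` may be empty. -/
def JumpsIn (X : ι ⥤ C) (T : Finset ι) : Prop :=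
  ∀ ⦃a b : ι⦄ (φ : a ⟶ b), (∀ t ∈ T, a < t → b < t) → IsIso (X.map φ)

theorem JumpsIn.mono {X : ι ⥤ C} {T T' : Finset ι} (hX : JumpsIn X T) (hT : T ⊆ T') :
    JumpsIn X T' :=
  fun _ _ φ h => hX φ fun t ht => h t (hT ht)

theorem JumpsIn.isIso_map_or_exists {X : ι ⥤ C} {T : Finset ι} (hX : JumpsIn X T) {a b : ι}
    (φ : a ⟶ b) :
    IsIso (X.map φ) ∨ ∃ c ∈ T, a < c ∧ ∃ ψ : c ⟶ b, IsIso (X.map ψ) := by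
  rcases (T.filter fun c => a < c ∧ c ≤ b).eq_empty_or_nonempty with hempty | hne
  · exact Or.inl (hX φ fun t ht hat => not_le.1 fun htb =>
      Finset.filter_eq_empty_iff.1 hempty ht ⟨hat, htb⟩)
  · set c := (T.filter fun c => a < c ∧ c ≤ b).max' hne
    obtain ⟨hcT, hac, hcb⟩ := Finset.mem_filter.1 (Finset.max'_mem _ hne)
    refine Or.inr ⟨c, hcT, hac, homOfLE hcb, hX _ fun t ht hct => ?_⟩
    by_contra! htb
    exact hct.not_ge (Finset.le_max' _ t (Finset.mem_filter.2 ⟨ht, hac.trans hct, htb⟩))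

theorem isTame_iff {X : Persistent C} : IsTame X ↔ ∃ T : Finset ℝ≥0, JumpsIn X T := by
  classical
  constructor
  · rintro ⟨n, t, -, ht⟩
    refine ⟨Finset.univ.image t, fun a b φ h => ?_⟩
    rcases (leOfHom φ).eq_or_lt with rfl | hab
    · rw [Subsingleton.elim φ (𝟙 a)]
      infer_instance
    · by_contra hiso
      obtain ⟨i, hi, hi'⟩ := ht a b hab hiso
      exact hi'.not_gt (h _ (by simp) hi)
  · rintro ⟨T, hT⟩
    have hcard : (insert 0 T).card = (insert 0 T).card - 1 + 1 :=
      (Nat.succ_pred (Finset.card_ne_zero_of_mem (Finset.mem_insert_self 0 T))).symm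
    refine ⟨_, (insert 0 T).orderEmbOfFin hcard, OrderEmbedding.strictMono _,
      fun a b hab hiso => ?_⟩
    by_contra! hno
    refine hiso (hT _ fun t ht hat => ?_)
    obtain ⟨i, rfl⟩ : t ∈ Set.range ((insert 0 T).orderEmbOfFin hcard) := by simp [ht]
    exact hno i hat

theorem IsTame.comp {D : Type*} [Category* D] {X : Persistent C} (hX : IsTame X) (F : C ⥤ D) :
    IsTame (X ⋙ F) := by
  obtain ⟨T, hT⟩ := isTame_iff.1 hX
  refine isTame_iff.2 ⟨T, fun a b φ h => ?_⟩
  have := hT φ h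
  exact inferInstanceAs (IsIso (F.map (X.map φ)))

end Jumps

/-! ### Barcodes -/

section Barcodes

universe w

variable {ι : Type*} [LinearOrder ι] {K : Type*} [DivisionRing K] {V : ι ⥤ ModuleCat.{w} K}

theorem map_map_apply {a b c : ι} (φ : a ⟶ b) (ψ : b ⟶ c) (χ : a ⟶ c) (v : V.obj a) :
    V.map ψ (V.map φ v) = V.map χ v := by
  rw [← ConcreteCategory.comp_apply, ← V.map_comp, Subsingleton.elim (φ ≫ ψ) χ]

theorem map_self_apply {a : ι} (φ : a ⟶ a) (v : V.obj a) : V.map φ v = v := by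
  rw [Subsingleton.elim φ (𝟙 a), V.map_id, ModuleCat.id_apply]

/-- The images at time `r` of those elements `v γ`, given at the times `s γ`, whose interval
`[s γ, t γ)` contains `r`. -/
def aliveAt {Γ : Type*} (s : Γ → ι) (t : Γ → WithTop ι) (v : ∀ γ, V.obj (s γ)) (r : ι) :
    {γ // s γ ≤ r ∧ (r : WithTop ι) < t γ} → V.obj r :=
  fun γ => V.map (homOfLE γ.2.1) (v γ.1)

/-- The elements `v γ` of `V` at the times `s γ` vanish from the times `t γ` on, and those which
are alive at a time `r` form a basis of the subspace `U r` of `V r`. Allowing for proper subspaces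
makes it possible to build a barcode of `V` out of barcodes of a submodule and of a quotient. -/
structure IsBarcode (U : ∀ r, Submodule K (V.obj r)) {Γ : Type*} (s : Γ → ι)
    (t : Γ → WithTop ι) (v : ∀ γ, V.obj (s γ)) : Prop where
  lt : ∀ γ, (s γ : WithTop ι) < t γ
  map_eq_zero : ∀ γ r (φ : s γ ⟶ r), t γ ≤ (r : WithTop ι) → V.map φ (v γ) = 0
  linearIndependent : ∀ r, LinearIndependent K (aliveAt s t v r)
  span_eq : ∀ r, Submodule.span K (Set.range (aliveAt s t v r)) = U r

theorem IsBarcode.ne_zero {U : ∀ r, Submodule K (V.obj r)} {Γ : Type*} {s : Γ → ι}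
    {t : Γ → WithTop ι} {v : ∀ γ, V.obj (s γ)} (h : IsBarcode U s t v) (γ : Γ) : v γ ≠ 0 := by
  have := (h.linearIndependent (s γ)).ne_zero ⟨γ, le_rfl, h.lt γ⟩
  rwa [aliveAt, map_self_apply] at this

theorem exists_death_time {T : Finset ι} (hV : JumpsIn V T) {σ : ι} {v : V.obj σ} (hv : v ≠ 0) :
    ∃ t : WithTop ι, ∀ r (φ : σ ⟶ r), t ≤ (r : WithTop ι) ↔ V.map φ v = 0 := by
  classical
  let D := T.filter fun c => ∃ φ : σ ⟶ c, V.map φ v = 0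
  refine ⟨D.min, fun r φ => ⟨fun hr => ?_, fun h0 => ?_⟩⟩
  · obtain ⟨c, hc⟩ := WithTop.ne_top_iff_exists.1 (ne_top_of_le_ne_top WithTop.coe_ne_top hr)
    obtain ⟨-, χ, hχ⟩ := Finset.mem_filter.1 (Finset.mem_of_min hc.symm)
    have hcr : c ≤ r := WithTop.coe_le_coe.1 (hc ▸ hr)
    rw [← map_map_apply χ (homOfLE hcr), hχ, map_zero]
  · rcases hV.isIso_map_or_exists φ with hφ | ⟨c, hc, hσc, ψ, hψ⟩
    · exact absurd ((map_eq_zero_iff _ (ConcreteCategory.bijective_of_isIso (V.map φ)).1).1 h0) hv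
    · rw [← map_map_apply (homOfLE hσc.le) ψ] at h0
      have hc0 := (map_eq_zero_iff _ (ConcreteCategory.bijective_of_isIso (V.map ψ)).1).1 h0
      exact (Finset.min_le (Finset.mem_filter.2 ⟨hc, _, hc0⟩)).trans
        (WithTop.coe_le_coe.2 (leOfHom ψ))

theorem exists_basis_adapted_ker {T : Finset ι} (hV : JumpsIn V T) (σ : ι) :
    ∃ B : Set (V.obj σ), LinearIndepOn K id B ∧ Submodule.span K B = ⊤ ∧
      ∀ r (φ : σ ⟶ r), LinearMap.ker (V.map φ).hom ≤
        Submodule.span K (B ∩ LinearMap.ker (V.map φ).hom) := by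
  let U : Set.Ici σ → Submodule K (V.obj σ) := fun r => LinearMap.ker (V.map (homOfLE r.2)).hom
  have hU : Monotone U := fun a b hab v (hv : V.map _ v = 0) => by
    change V.map (homOfLE b.2) v = 0
    rw [← map_map_apply (homOfLE a.2) (homOfLE hab), hv, map_zero]
  obtain ⟨B, hB, htop, hspan⟩ := exists_basis_adapted hU (T.subtype (σ ≤ ·))
  refine ⟨B, hB, htop, fun r φ => ?_⟩
  rcases hV.isIso_map_or_exists φ with hφ | ⟨c, hc, hσc, ψ, hψ⟩
  · rw [LinearMap.ker_eq_bot.2 (ConcreteCategory.bijective_of_isIso (V.map φ)).1]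
    exact bot_le
  · have hker : LinearMap.ker (V.map φ).hom = U ⟨c, hσc.le⟩ := by
      have hcomp : V.map φ = V.map (homOfLE hσc.le) ≫ V.map ψ := by
        rw [← V.map_comp, Subsingleton.elim φ]
      rw [hcomp, ModuleCat.hom_comp]
      exact LinearMap.ker_comp_of_ker_eq_bot _
        (LinearMap.ker_eq_bot.2 (ConcreteCategory.bijective_of_isIso (V.map ψ)).1)
    rw [hker]
    exact hspan ⟨c, hσc.le⟩ (Finset.mem_subtype.2 hc)

/-- The part of `V` at time `r` which was born by the time `σ`, and stays alive until `r`; it is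
`0` at the times before `σ`. -/
def imageFrom (V : ι ⥤ ModuleCat.{w} K) (σ r : ι) : Submodule K (V.obj r) :=
  ⨆ h : σ ≤ r, LinearMap.range (V.map (homOfLE h)).hom

theorem imageFrom_eq_range {σ r : ι} (φ : σ ⟶ r) :
    imageFrom V σ r = LinearMap.range (V.map φ).hom :=
  iSup_pos (leOfHom φ)

theorem imageFrom_eq_bot {σ r : ι} (h : ¬ σ ≤ r) : imageFrom V σ r = ⊥ :=
  iSup_neg h

theorem map_imageFrom {σ a b : ι} (h : σ ≤ a) (φ : a ⟶ b) :
    (imageFrom V σ a).map (V.map φ).hom = imageFrom V σ b := by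
  rw [imageFrom_eq_range (homOfLE h), imageFrom_eq_range (homOfLE h ≫ φ), V.map_comp,
    ModuleCat.hom_comp, LinearMap.range_comp]

theorem imageFrom_le_comap {σ a b : ι} (φ : a ⟶ b) :
    imageFrom V σ a ≤ (imageFrom V σ b).comap (V.map φ).hom := by
  by_cases h : σ ≤ a
  · rw [← Submodule.map_le_iff_le_comap, map_imageFrom h]
  · rw [imageFrom_eq_bot h]
    exact bot_le

theorem exists_isBarcode_imageFrom {T : Finset ι} (hV : JumpsIn V T) (σ : ι) :
    ∃ (Γ : Type w) (t : Γ → WithTop ι) (v : Γ → V.obj σ),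
      IsBarcode (imageFrom V σ) (fun _ => σ) t v := by
  obtain ⟨B, hB, htop, hspan⟩ := exists_basis_adapted_ker hV σ
  choose t ht using fun v : B => exists_death_time hV (hB.ne_zero v.2)
  have mem_diff : ∀ (v : B) {r} (φ : σ ⟶ r), (r : WithTop ι) < t v ↔
      v.1 ∈ B \ LinearMap.ker (V.map φ).hom := fun v r φ => by
    rw [← not_le, ht v r φ]
    exact (and_iff_right v.2).symm
  refine ⟨B, t, Subtype.val, ⟨fun v => ?_, fun v r φ => (ht v r φ).1, fun r => ?_, fun r => ?_⟩⟩
  · rw [mem_diff v (𝟙 σ)]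
    exact ⟨v.2, fun h => hB.ne_zero v.2 ((map_self_apply _ _).symm.trans h)⟩
  · by_cases h : σ ≤ r
    · have hind := linearIndepOn_diff_ker hB (hspan r (homOfLE h))
      exact hind.linearIndependent.comp
        (fun v : {v : B // σ ≤ r ∧ (r : WithTop ι) < t v} =>
          ⟨v.1.1, (mem_diff v.1 (homOfLE h)).1 v.2.2⟩)
        fun v w hvw => Subtype.ext (Subtype.ext (congrArg (fun x => x.1) hvw))
    · have : IsEmpty {v : B // σ ≤ r ∧ (r : WithTop ι) < t v} := ⟨fun v => h v.2.1⟩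
      exact linearIndependent_empty_type
  · by_cases h : σ ≤ r
    · rw [imageFrom_eq_range (homOfLE h), ← Submodule.map_top, ← htop, ← span_image_diff_ker]
      congr 1
      ext x
      constructor
      · rintro ⟨v, rfl⟩
        exact ⟨v.1.1, (mem_diff v.1 _).1 v.2.2, rfl⟩
      · rintro ⟨v, hv, rfl⟩
        exact ⟨⟨⟨v, hv.1⟩, h, (mem_diff ⟨v, hv.1⟩ _).2 hv⟩, rfl⟩
    · have : IsEmpty {v : B // σ ≤ r ∧ (r : WithTop ι) < t v} := ⟨fun v => h v.2.1⟩
      rw [imageFrom_eq_bot h, Set.range_eq_empty, Submodule.span_empty]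

/-- The quotient of `V` by a family of subspaces preserved by the structure maps. -/
def quotient (V : ι ⥤ ModuleCat.{w} K) (U : ∀ r, Submodule K (V.obj r))
    (hU : ∀ ⦃a b⦄ (φ : a ⟶ b), U a ≤ (U b).comap (V.map φ).hom) : ι ⥤ ModuleCat.{w} K where
  obj r := ModuleCat.of K (V.obj r ⧸ U r)
  map φ := ModuleCat.ofHom (Submodule.mapQ _ _ (V.map φ).hom (hU φ))
  map_id r := by
    apply ModuleCat.hom_ext
    apply Submodule.linearMap_qext
    ext x
    simp
  map_comp f g := by
    apply ModuleCat.hom_ext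
    apply Submodule.linearMap_qext
    ext x
    simp

variable {U : ∀ r, Submodule K (V.obj r)}
  {hU : ∀ ⦃a b⦄ (φ : a ⟶ b), U a ≤ (U b).comap (V.map φ).hom}

theorem isIso_quotient_map {a b : ι} (φ : a ⟶ b) [IsIso (V.map φ)]
    (hab : (U a).map (V.map φ).hom = U b) : IsIso ((quotient V U hU).map φ) :=
  (Submodule.Quotient.equiv (U a) (U b) (asIso (V.map φ)).toLinearEquiv hab).toModuleIso.isIso_hom

theorem exists_lift_of_quotient {s : ι} {t : WithTop ι} (q : (quotient V U hU).obj s)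
    (hst : (s : WithTop ι) < t)
    (hq : ∀ r (φ : s ⟶ r), t ≤ (r : WithTop ι) → (quotient V U hU).map φ q = 0)
    (hs : ∀ ⦃r⦄ (φ : s ⟶ r), (U s).map (V.map φ).hom = U r) :
    ∃ v : V.obj s, Submodule.Quotient.mk v = q ∧
      ∀ r (φ : s ⟶ r), t ≤ (r : WithTop ι) → V.map φ v = 0 := by
  obtain ⟨v, rfl⟩ := Submodule.Quotient.mk_surjective _ q
  induction t using WithTop.recTopCoe with
  | top => exact ⟨v, rfl, fun r φ hr => absurd (WithTop.coe_lt_top r) hr.not_gt⟩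
  | coe d =>
    have hsd : s ⟶ d := homOfLE (WithTop.coe_lt_coe.1 hst).le
    have hvd : V.map hsd v ∈ U d := (Submodule.Quotient.mk_eq_zero _).1 (hq d hsd le_rfl)
    -- A lift dies at `d` only up to an element of `U d`, which comes from `U s` by `hs`.
    obtain ⟨u, hu, huv⟩ := (hs hsd).ge hvd
    refine ⟨v - u, (Submodule.Quotient.eq _).2 (by simpa using hu), fun r φ hr => ?_⟩
    rw [← map_map_apply hsd (homOfLE (WithTop.coe_le_coe.1 hr)), map_sub]
    exact (congrArg _ (sub_eq_zero.2 huv.symm)).trans (map_zero _)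

theorem IsBarcode.sum {Γ Γ' : Type*} {s : Γ → ι} {t : Γ → WithTop ι} {v : ∀ γ, V.obj (s γ)}
    (hv : IsBarcode U s t v) {s' : Γ' → ι} {t' : Γ' → WithTop ι} {v' : ∀ γ, V.obj (s' γ)}
    (hv' : IsBarcode (V := quotient V U hU) (fun _ => ⊤) s' t'
      fun γ => Submodule.Quotient.mk (v' γ))
    (hzero : ∀ γ r (φ : s' γ ⟶ r), t' γ ≤ (r : WithTop ι) → V.map φ (v' γ) = 0) :
    IsBarcode (V := V) (fun _ => ⊤) (Sum.elim s s') (Sum.elim t t')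
      (Sum.rec v v') := by
  let S r := {γ // s γ ≤ r ∧ (r : WithTop ι) < t γ}
  let S' r := {γ // s' γ ≤ r ∧ (r : WithTop ι) < t' γ}
  let e r : {γ : Γ ⊕ Γ' // Sum.elim s s' γ ≤ r ∧ (r : WithTop ι) < Sum.elim t t' γ} ≃
      S r ⊕ S' r := Equiv.subtypeSum
  have halive : ∀ r, aliveAt (V := V) (Sum.elim s s') (Sum.elim t t') (Sum.rec v v') r =
      Sum.elim (aliveAt s t v r) (aliveAt s' t' v' r) ∘ e r := by
    intro r
    funext γ
    rcases γ with ⟨γ | γ, h⟩ <;> rfl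
  refine ⟨Sum.rec hv.lt hv'.lt, Sum.rec hv.map_eq_zero hzero, fun r => ?_, fun r => ?_⟩
  · rw [halive, linearIndependent_equiv]
    have hmem : ∀ γ, aliveAt s t v r γ ∈ U r := fun γ =>
      hv.span_eq r ▸ Submodule.subset_span ⟨γ, rfl⟩
    have hind : LinearIndependent K fun γ => (⟨_, hmem γ⟩ : U r) :=
      LinearIndependent.of_comp (U r).subtype (hv.linearIndependent r)
    exact hind.sumElim_of_quotient _ (hv'.linearIndependent r)
  · rw [halive, EquivLike.range_comp, Set.Sum.elim_range, Submodule.span_union, hv.span_eq,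
      ← Submodule.map_mkQ_eq_top, Submodule.map_span, ← Set.range_comp]
    exact hv'.span_eq r

theorem subsingleton_quotient_imageFrom {σ : ι} {T : Finset ι} (hV : JumpsIn V (insert σ T))
    (hV₀ : ∀ r, r < σ → Subsingleton (V.obj r)) {r : ι} (hr : ∀ t ∈ T, r < t) :
    Subsingleton ((quotient V (imageFrom V σ) fun _ _ => imageFrom_le_comap).obj r) := by
  refine Submodule.Quotient.subsingleton_iff.2 ?_
  by_cases h : σ ≤ r
  · have := hV (homOfLE h) fun t ht hσt =>
      hr t ((Finset.mem_insert.1 ht).resolve_left hσt.ne')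
    rw [imageFrom_eq_range (homOfLE h), LinearMap.range_eq_top]
    exact (ConcreteCategory.bijective_of_isIso (V.map (homOfLE h))).2
  · have := hV₀ r (not_le.1 h)
    exact Subsingleton.elim _ _

theorem jumpsIn_quotient_imageFrom {σ : ι} {T : Finset ι} (hσ : ∀ t ∈ T, σ < t)
    (hV : JumpsIn V (insert σ T)) (hV₀ : ∀ r, r < σ → Subsingleton (V.obj r)) :
    JumpsIn (quotient V (imageFrom V σ) fun _ _ => imageFrom_le_comap) T := by
  intro a b φ hab
  by_cases ha : σ ≤ a
  · have := hV φ fun t ht hat => hab t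
      ((Finset.mem_insert.1 ht).resolve_left (ha.trans_lt hat).ne') hat
    exact isIso_quotient_map φ (map_imageFrom ha φ)
  · have hb : ∀ t ∈ T, b < t := fun t ht => hab t ht ((not_le.1 ha).trans (hσ t ht))
    have hzero : ∀ {r}, (∀ t ∈ T, r < t) → IsZero ((quotient V (imageFrom V σ)
        fun _ _ => imageFrom_le_comap).obj r) := fun hr =>
      have := subsingleton_quotient_imageFrom hV hV₀ hr
      ModuleCat.isZero_of_subsingleton _
    exact isIso_of_source_target_iso_zero _
      (hzero fun t ht => (leOfHom φ).trans_lt (hb t ht)).isoZero (hzero hb).isoZero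

theorem exists_isBarcode {T : Finset ι} {V : ι ⥤ ModuleCat.{w} K} (hV : JumpsIn V T)
    (hV₀ : ∀ r, (∀ t ∈ T, r < t) → Subsingleton (V.obj r)) :
    ∃ (Γ : Type w) (s : Γ → ι) (t : Γ → WithTop ι) (v : ∀ γ, V.obj (s γ)),
      IsBarcode (fun _ => ⊤) s t v := by
  induction T using Finset.induction_on_min generalizing V with
  | empty =>
    have hsub : ∀ r, Subsingleton (V.obj r) := fun r => hV₀ r (by simp)
    exact ⟨PEmpty, PEmpty.elim, PEmpty.elim, fun γ => γ.elim, fun γ => γ.elim, fun γ => γ.elim,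
      fun r => have : IsEmpty {γ : PEmpty // γ.elim ≤ r ∧ (r : WithTop ι) < γ.elim} :=
          ⟨fun γ => γ.1.elim⟩
        linearIndependent_empty_type, fun r => Subsingleton.elim _ _⟩
  | insert σ T hσ ih =>
    have hVσ : ∀ r, r < σ → Subsingleton (V.obj r) := fun r hr =>
      hV₀ r (Finset.forall_mem_insert .. |>.2 ⟨hr, fun t ht => hr.trans (hσ t ht)⟩)
    obtain ⟨Γ, s, t, q, hq⟩ := ih (jumpsIn_quotient_imageFrom hσ hV hVσ)
      fun r => subsingleton_quotient_imageFrom hV hVσ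
    have hs : ∀ γ, σ ≤ s γ := fun γ => by
      by_contra! hlt
      have := subsingleton_quotient_imageFrom hV hVσ fun t ht => hlt.trans (hσ t ht)
      exact hq.ne_zero γ (Subsingleton.elim _ _)
    choose v hvq hv using fun γ => exists_lift_of_quotient (q γ) (hq.lt γ) (hq.map_eq_zero γ)
      fun r φ => map_imageFrom (hs γ) φ
    obtain rfl : (fun γ => Submodule.Quotient.mk (v γ)) = q := funext hvq
    obtain ⟨Γ₀, t₀, v₀, hv₀⟩ := exists_isBarcode_imageFrom hV σ
    exact ⟨Γ₀ ⊕ Γ, _, _, _, hv₀.sum hq hv⟩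

end Barcodes

/-! ### Persistence modules supported on a convex set of times -/

theorem QIf.one_eq_zero {P : Prop} (h : ¬ P) : QIf.one P = 0 :=
  funext fun p => absurd p.down h

theorem QIf.map_one {P Q : Prop} (h : P) : QIf.map P Q (QIf.one P) = QIf.one Q :=
  funext (QIf.linearMap_of Q h _)

theorem QIf.hom_ext {P : Prop} {M : ModuleCat.{0} ℚ} {f g : QIf P ⟶ M}
    (h : P → f (QIf.one P) = g (QIf.one P)) : f = g := by
  refine ModuleCat.hom_ext (LinearMap.ext fun x => ?_)
  change f x = g x
  by_cases hP : P
  · have hx : x = (x : PLift P → ℚ) ⟨hP⟩ • QIf.one P := funext fun _ => (mul_one _).symm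
    rw [hx, map_smul, map_smul, h hP]
  · obtain rfl : x = 0 := funext fun p => absurd p.down hP
    rw [map_zero, map_zero]

open Classical in
/-- The map `QIf P ⟶ M` which takes `1` to `x`. -/
def QIf.desc {P : Prop} {M : ModuleCat.{0} ℚ} (x : P → M) : QIf P ⟶ M :=
  ModuleCat.ofHom
    (if h : P then (LinearMap.proj (R := ℚ) (φ := fun _ : PLift P => ℚ) ⟨h⟩).smulRight (x h)
      else 0)

theorem QIf.desc_one {P : Prop} {M : ModuleCat.{0} ℚ} (x : P → M) (h : P) :
    QIf.desc x (QIf.one P) = x h := by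
  simp only [QIf.desc, dif_pos h]
  exact one_smul _ _

/-- The persistence module which is `ℚ`, with identity structure maps, at the times in a convex
set `P`, and `0` at all other times. Interval modules are of this form, and so are, in each degree,
persistent disks and interval spheres. -/
def supportModule (P : ℝ≥0 → Prop) (hP : Set.OrdConnected {r | P r}) : PVec where
  obj r := QIf (P r)
  map _ := QIf.map _ _
  map_id _ := QIf.map_self _
  map_comp f g := (QIf.map_comp _ _ _ fun h h' => hP.out h h' ⟨leOfHom f, leOfHom g⟩).symm

namespace supportModule

variable {P : ℝ≥0 → Prop} {hP : Set.OrdConnected {r | P r}} {V : PVec} {r r' s : ℝ≥0}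

/-- The element `1` at time `r`, which is `0` if `r` is not in `P`. -/
def one (hP : Set.OrdConnected {r | P r}) (r : ℝ≥0) : (supportModule P hP).obj r := QIf.one (P r)

theorem one_eq_zero (h : ¬ P r) : one hP r = 0 :=
  QIf.one_eq_zero h

theorem map_one (φ : r ⟶ r') (h : P r) : (supportModule P hP).map φ (one hP r) = one hP r' :=
  QIf.map_one h

theorem hom_ext {f g : supportModule P hP ⟶ V}
    (h : ∀ r, P r → f.app r (one hP r) = g.app r (one hP r)) : f = g := by
  ext1
  exact funext fun r => QIf.hom_ext (h r)

theorem hom_ext_of_gen (hs : ∀ r, P r → s ≤ r ∧ P s) {f g : supportModule P hP ⟶ V}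
    (h : P s → f.app s (one hP s) = g.app s (one hP s)) : f = g := by
  refine hom_ext fun r hr => ?_
  obtain ⟨hsr, hPs⟩ := hs r hr
  rw [← map_one (homOfLE hsr) hPs, NatTrans.naturality_apply, NatTrans.naturality_apply, h hPs]

/-- The map from the persistence module supported on `P` which takes `1` to the images of an
element of `V` at time `s`, where `s` is a lower bound of `P`. -/
def desc (hs : ∀ r, P r → s ≤ r) (v : V.obj s)
    (hv : ∀ r (φ : s ⟶ r), ¬ P r → V.map φ v = 0) : supportModule P hP ⟶ V where
  app r := QIf.desc fun h => V.map (homOfLE (hs r h)) v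
  naturality r r' φ := by
    refine QIf.hom_ext fun hr => ?_
    change QIf.desc _ (QIf.map _ _ (QIf.one _)) = V.map φ (QIf.desc _ (QIf.one _))
    rw [QIf.map_one hr, QIf.desc_one _ hr, map_map_apply _ φ (homOfLE (hs r hr) ≫ φ)]
    by_cases hr' : P r'
    · exact QIf.desc_one _ hr'
    · rw [QIf.one_eq_zero hr', map_zero, hv _ _ hr']

theorem desc_app_one (hs : ∀ r, P r → s ≤ r) (v : V.obj s)
    (hv : ∀ r (φ : s ⟶ r), ¬ P r → V.map φ v = 0) (φ : s ⟶ r) :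
    (desc hs v hv).app r (one hP r) = V.map φ v := by
  by_cases hr : P r
  · exact QIf.desc_one _ hr
  · rw [one_eq_zero hr, map_zero, hv r φ hr]

end supportModule

/-! ### Interval decompositions -/

section IntervalModules

variable {s : ℝ≥0} {t : WithTop ℝ≥0} {V : PVec}

theorem intervalModule.ordConnected (s : ℝ≥0) (t : WithTop ℝ≥0) :
    Set.OrdConnected {r : ℝ≥0 | s ≤ r ∧ (r : WithTop ℝ≥0) < t} :=
  ⟨fun _ ha _ hb _ hr => ⟨ha.1.trans hr.1, (WithTop.coe_le_coe.2 hr.2).trans_lt hb.2⟩⟩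

theorem intervalModule.hom_ext {f g : intervalModule s t ⟶ V}
    (h : f.app s (intervalModule.gen s t) = g.app s (intervalModule.gen s t)) : f = g :=
  supportModule.hom_ext_of_gen (hP := ordConnected s t)
    (fun _ hr => ⟨hr.1, le_rfl, (WithTop.coe_le_coe.2 hr.1).trans_lt hr.2⟩) fun _ => h

theorem intervalModule.map_gen_eq_zero {r : ℝ≥0} (φ : s ⟶ r) (hr : t ≤ (r : WithTop ℝ≥0)) :
    (intervalModule s t).map φ (intervalModule.gen s t) = 0 :=
  funext fun p => absurd p.down.2 hr.not_gt

/-- The map from the interval module of `[s, t)` defined by an element at time `s` which vanishes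
from the time `t` on. -/
def intervalModule.desc (v : V.obj s)
    (hv : ∀ r (φ : s ⟶ r), t ≤ (r : WithTop ℝ≥0) → V.map φ v = 0) : intervalModule s t ⟶ V :=
  supportModule.desc (hP := ordConnected s t) (fun _ hr => hr.1) v fun r φ hr =>
    hv r φ (not_lt.1 fun h => hr ⟨leOfHom φ, h⟩)

theorem intervalModule.desc_gen (v : V.obj s)
    (hv : ∀ r (φ : s ⟶ r), t ≤ (r : WithTop ℝ≥0) → V.map φ v = 0) :
    (intervalModule.desc v hv).app s (intervalModule.gen s t) = v :=
  (supportModule.desc_app_one (hP := ordConnected s t) _ v _ (𝟙 s)).trans (map_self_apply _ v)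

end IntervalModules

section IntervalDecompositions

variable {Γ : Type} {s : Γ → ℝ≥0} {t : Γ → WithTop ℝ≥0} {V V' : PVec} {v : ∀ γ, V.obj (s γ)}
  {v' : ∀ γ, V'.obj (s γ)}

namespace IsIntervalDecomposition

theorem map_eq_zero (h : IsIntervalDecomposition s t V v) (γ : Γ) {r : ℝ≥0} (φ : s γ ⟶ r)
    (hr : t γ ≤ (r : WithTop ℝ≥0)) : V.map φ (v γ) = 0 := by
  obtain ⟨-, e, he⟩ := h
  rw [← he, ← NatTrans.naturality_apply, intervalModule.map_gen_eq_zero φ hr, map_zero]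

theorem hom_ext (h : IsIntervalDecomposition s t V v) {f g : V ⟶ V'}
    (hfg : ∀ γ, f.app (s γ) (v γ) = g.app (s γ) (v γ)) : f = g := by
  obtain ⟨-, e, he⟩ := h
  rw [← cancel_epi e.hom]
  refine Sigma.hom_ext _ _ fun γ => intervalModule.hom_ext ?_
  have := hfg γ
  rwa [← he] at this

theorem exists_desc (h : IsIntervalDecomposition s t V v)
    (hv' : ∀ γ r (φ : s γ ⟶ r), t γ ≤ (r : WithTop ℝ≥0) → V'.map φ (v' γ) = 0) :
    ∃ f : V ⟶ V', ∀ γ, f.app (s γ) (v γ) = v' γ := by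
  obtain ⟨-, e, he⟩ := h
  refine ⟨e.inv ≫ Sigma.desc fun γ => intervalModule.desc (v' γ) (hv' γ), fun γ => ?_⟩
  rw [← he, ← intervalModule.desc_gen (v' γ) (hv' γ), ← ConcreteCategory.comp_apply,
    ← NatTrans.comp_app]
  simp

theorem of_iso (h : IsIntervalDecomposition s t V v) (e : V ≅ V')
    (hv : ∀ γ, e.hom.app (s γ) (v γ) = v' γ) : IsIntervalDecomposition s t V' v' := by
  obtain ⟨hlt, e', he'⟩ := h
  refine ⟨hlt, e' ≪≫ e, fun γ => ?_⟩
  rw [← hv, ← he', Iso.trans_hom, ← Category.assoc, NatTrans.comp_app,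
    ConcreteCategory.comp_apply]

theorem of_hom_ext_of_exists_desc (lt : ∀ γ, (s γ : WithTop ℝ≥0) < t γ)
    (map_eq_zero : ∀ γ r (φ : s γ ⟶ r), t γ ≤ (r : WithTop ℝ≥0) → V.map φ (v γ) = 0)
    (hom_ext : ∀ {f g : V ⟶ V}, (∀ γ, f.app (s γ) (v γ) = g.app (s γ) (v γ)) → f = g)
    (exists_desc : ∀ {V' : PVec} (v' : ∀ γ, V'.obj (s γ)),
      (∀ γ r (φ : s γ ⟶ r), t γ ≤ (r : WithTop ℝ≥0) → V'.map φ (v' γ) = 0) →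
        ∃ f : V ⟶ V', ∀ γ, f.app (s γ) (v γ) = v' γ) :
    IsIntervalDecomposition s t V v := by
  let ι := Sigma.ι fun γ => intervalModule (s γ) (t γ)
  let p : (∐ fun γ => intervalModule (s γ) (t γ)) ⟶ V :=
    Sigma.desc fun γ => intervalModule.desc (v γ) (map_eq_zero γ)
  have hp : ∀ γ, p.app (s γ) ((ι γ).app (s γ) (intervalModule.gen _ _)) = v γ := fun γ => by
    rw [← ConcreteCategory.comp_apply, ← NatTrans.comp_app, Sigma.ι_desc,
      intervalModule.desc_gen]
  obtain ⟨q, hq⟩ := exists_desc (fun γ => (ι γ).app (s γ) (intervalModule.gen _ _))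
    fun γ r φ hr => by
      rw [← NatTrans.naturality_apply, intervalModule.map_gen_eq_zero φ hr, map_zero]
  refine ⟨lt, ⟨p, q, ?_, hom_ext fun γ => ?_⟩, hp⟩
  · refine Sigma.hom_ext _ _ fun γ => intervalModule.hom_ext ?_
    exact (congrArg _ (hp γ)).trans (hq γ)
  · exact (congrArg _ (hq γ)).trans (hp γ)

theorem isIso (h : IsIntervalDecomposition s t V' v') {f : V ⟶ V'}
    (hf : ∀ γ, f.app (s γ) (v γ) = v' γ)
    (map_eq_zero : ∀ γ r (φ : s γ ⟶ r), t γ ≤ (r : WithTop ℝ≥0) → V.map φ (v γ) = 0)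
    (hom_ext : ∀ {f g : V ⟶ V}, (∀ γ, f.app (s γ) (v γ) = g.app (s γ) (v γ)) → f = g) :
    IsIso f := by
  obtain ⟨g, hg⟩ := h.exists_desc map_eq_zero
  refine ⟨g, hom_ext fun γ => ?_, h.hom_ext fun γ => ?_⟩
  · exact (congrArg _ (hf γ)).trans (hg γ)
  · exact (congrArg _ (hg γ)).trans (hf γ)

end IsIntervalDecomposition

namespace IsBarcode

theorem hom_ext (h : IsBarcode (fun _ => ⊤) s t v) {f g : V ⟶ V'}
    (hfg : ∀ γ, f.app (s γ) (v γ) = g.app (s γ) (v γ)) : f = g := by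
  ext1
  refine funext fun r => ModuleCat.hom_ext (LinearMap.ext_on_range (h.span_eq r) fun γ => ?_)
  change f.app r (V.map _ _) = g.app r (V.map _ _)
  rw [NatTrans.naturality_apply, NatTrans.naturality_apply, hfg]

theorem exists_desc (h : IsBarcode (fun _ => ⊤) s t v)
    (hv' : ∀ γ r (φ : s γ ⟶ r), t γ ≤ (r : WithTop ℝ≥0) → V'.map φ (v' γ) = 0) :
    ∃ f : V ⟶ V', ∀ γ, f.app (s γ) (v γ) = v' γ := by
  let b r := Module.Basis.mk (h.linearIndependent r) (h.span_eq r).ge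
  let f r : V.obj r ⟶ V'.obj r := ModuleCat.ofHom ((b r).constr ℚ (aliveAt s t v' r))
  have hf : ∀ γ r (φ : s γ ⟶ r), f r (V.map φ (v γ)) = V'.map φ (v' γ) := fun γ r φ => by
    by_cases hr : (r : WithTop ℝ≥0) < t γ
    · have hb : b r ⟨γ, leOfHom φ, hr⟩ = V.map φ (v γ) :=
        Module.Basis.mk_apply (h.linearIndependent r) (h.span_eq r).ge _
      rw [← hb]
      exact (b r).constr_basis ℚ _ _
    · rw [h.map_eq_zero γ r φ (not_lt.1 hr), hv' γ r φ (not_lt.1 hr), map_zero]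
  refine ⟨{ app := f, naturality := fun r r' φ => ?_ }, fun γ => ?_⟩
  · refine ModuleCat.hom_ext (LinearMap.ext_on_range (h.span_eq r) fun γ => ?_)
    change f r' (V.map φ (V.map (homOfLE γ.2.1) (v γ.1))) =
      V'.map φ (f r (V.map (homOfLE γ.2.1) (v γ.1)))
    rw [map_map_apply _ φ (homOfLE γ.2.1 ≫ φ), hf, hf, map_map_apply]
  · simpa only [map_self_apply] using hf γ (s γ) (𝟙 _)

theorem isIntervalDecomposition (h : IsBarcode (fun _ => ⊤) s t v) :
    IsIntervalDecomposition s t V v :=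
  .of_hom_ext_of_exists_desc h.lt h.map_eq_zero h.hom_ext fun _ => h.exists_desc

end IsBarcode

theorem IsTame.exists_isIntervalDecomposition (hV : IsTame V) :
    ∃ (Γ : Type) (s : Γ → ℝ≥0) (t : Γ → WithTop ℝ≥0) (v : ∀ γ, V.obj (s γ)),
      IsIntervalDecomposition s t V v := by
  classical
  obtain ⟨T, hT⟩ := isTame_iff.1 hV
  obtain ⟨Γ, s, t, v, h⟩ := exists_isBarcode (hT.mono (Finset.subset_insert 0 T))
    fun r hr => absurd (hr 0 (by simp)) not_lt_zero
  exact ⟨Γ, s, t, v, h.isIntervalDecomposition⟩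

theorem IsTame.exists_isIntervalDecomposition_of_epi (hV' : IsTame V') (p : V ⟶ V') [Epi p] :
    ∃ (Γ : Type) (s : Γ → ℝ≥0) (t : Γ → WithTop ℝ≥0) (v : ∀ γ, V.obj (s γ)),
      IsIntervalDecomposition s t V' fun γ => p.app (s γ) (v γ) := by
  obtain ⟨Γ, s, t, v', h⟩ := hV'.exists_isIntervalDecomposition
  choose v hv using fun γ => (ModuleCat.epi_iff_surjective (p.app (s γ))).1 inferInstance (v' γ)
  obtain rfl : (fun γ => p.app (s γ) (v γ)) = v' := funext hv
  exact ⟨Γ, s, t, v, h⟩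

end IntervalDecompositions

/-! ### Maps out of persistent disks -/

section Cochains

variable {A B : PCh}

/-- The differential of a persistent complex, as a map of persistence modules. -/
def differential (B : PCh) (i j : ℕ) : (cochains i).obj B ⟶ (cochains j).obj B :=
  Functor.whiskerLeft B (HomologicalComplex.dNatTrans _ _ i j)

theorem differential_differential_apply (i j l : ℕ) {r : ℝ≥0} (x : ((cochains i).obj B).obj r) :
    (differential B j l).app r ((differential B i j).app r x) = 0 :=
  ConcreteCategory.congr_hom ((B.obj r).d_comp_d i j l) x

theorem differential_cochains_map_apply (f : A ⟶ B) (i j : ℕ) {r : ℝ≥0}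
    (x : ((cochains i).obj A).obj r) :
    (differential B i j).app r (((cochains i).map f).app r x) =
      ((cochains j).map f).app r ((differential A i j).app r x) :=
  ConcreteCategory.congr_hom ((f.app r).comm i j) x

/-- The map of persistent complexes given by maps of persistence modules in all degrees. -/
def homOfCochains (f : ∀ k, (cochains k).obj A ⟶ (cochains k).obj B)
    (hf : ∀ k, f k ≫ differential B k (k + 1) = differential A k (k + 1) ≫ f (k + 1)) : A ⟶ B where
  app r :=
    { f k := (f k).app r
      comm' := by
        rintro k _ rfl
        exact congrArg (·.app r) (hf k) }
  naturality _ _ φ := HomologicalComplex.hom_ext _ _ fun k => (f k).naturality φ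

end Cochains

section Disks

variable {k j : ℕ} {s : ℝ≥0} {t : WithTop ℝ≥0} {B : PCh}

theorem diskSupport.ordConnected (k : ℕ) (s : ℝ≥0) (j : ℕ) :
    Set.OrdConnected {r | diskSupport k s r j} :=
  ⟨fun _ ha _ _ _ hr => ⟨ha.1.trans hr.1, ha.2⟩⟩

/-- The image of the generator of degree `j` at time `s` under the map `D_s^{k + 1} ⟶ B` defined
by `b`: it is `b` in degree `k` and the coboundary of `b` in degree `k + 1`. -/
def diskElement (b : ((cochains k).obj B).obj s) (j : ℕ) : ((cochains j).obj B).obj s :=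
  if h : k = j then h ▸ b else (differential B k j).app s b

theorem diskElement_self (b : ((cochains k).obj B).obj s) : diskElement b k = b := by
  simp [diskElement]

theorem diskElement_succ (b : ((cochains k).obj B).obj s) :
    diskElement b (k + 1) = (differential B k (k + 1)).app s b := by
  simp [diskElement]

theorem diskElement_eq_zero (b : ((cochains k).obj B).obj s) {r : ℝ≥0} (φ : s ⟶ r)
    (h : ¬ diskSupport (k + 1) s r j) : diskElement b j = 0 := by
  have hj : ¬ (j = k + 1 ∨ j + 1 = k + 1) := fun hj => h ⟨leOfHom φ, k.succ_ne_zero, hj⟩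
  rw [diskElement, dif_neg (by omega)]
  exact ConcreteCategory.congr_hom ((B.obj s).shape k j fun hkj => hj (.inl hkj.symm)) b

theorem differential_diskElement (b : ((cochains k).obj B).obj s) (hj : j ≠ k) :
    (differential B j (j + 1)).app s (diskElement b j) = 0 := by
  rw [diskElement, dif_neg hj.symm]
  exact differential_differential_apply _ _ _ b

namespace persistentDisk

/-- The element `1` of degree `j` of the persistent disk `D_s^k` at time `s`. The generator of
`D_s^{k + 1}` is the case `j = k`. -/
def one (k : ℕ) (s : ℝ≥0) (j : ℕ) : ((cochains j).obj (persistentDisk k s)).obj s :=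
  supportModule.one (diskSupport.ordConnected k s j) s

theorem one_eq_zero (hj : ¬ (j = k ∨ j + 1 = k)) : one k s j = 0 :=
  supportModule.one_eq_zero fun h => hj h.2.2

theorem differential_one (k : ℕ) (s : ℝ≥0) :
    (differential (persistentDisk (k + 1) s) k (k + 1)).app s (one (k + 1) s k) =
      one (k + 1) s (k + 1) := by
  have hd : ((persistentDisk (k + 1) s).obj s).d k (k + 1) = QIf.map _ _ := if_pos rfl
  exact (ConcreteCategory.congr_hom hd _).trans
    (QIf.map_one ⟨le_rfl, k.succ_ne_zero, .inr rfl⟩)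

theorem differential_one_eq_zero (s : ℝ≥0) (hj : j ≠ k) :
    (differential (persistentDisk (k + 1) s) j (j + 1)).app s (one (k + 1) s j) = 0 := by
  by_cases hjk : j = k + 1
  · subst hjk
    rw [← differential_one]
    exact differential_differential_apply _ _ _ _
  · rw [one_eq_zero (by omega), map_zero]

theorem cochains_hom_ext {V : PVec} {f g : (cochains j).obj (persistentDisk k s) ⟶ V}
    (h : f.app s (one k s j) = g.app s (one k s j)) : f = g :=
  supportModule.hom_ext_of_gen (hP := diskSupport.ordConnected k s j)
    (fun _ hr => ⟨hr.1, le_rfl, hr.2⟩) fun _ => h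

/-- The component in degree `j` of the map `D_s^{k + 1} ⟶ B` defined by `b`. -/
def cochainsDesc (b : ((cochains k).obj B).obj s) (j : ℕ) :
    (cochains j).obj (persistentDisk (k + 1) s) ⟶ (cochains j).obj B :=
  supportModule.desc (hP := diskSupport.ordConnected (k + 1) s j) (fun _ hr => hr.1)
    (diskElement b j) fun r φ hr => by rw [diskElement_eq_zero b φ hr, map_zero]

theorem cochainsDesc_one (b : ((cochains k).obj B).obj s) (j : ℕ) :
    (cochainsDesc b j).app s (one (k + 1) s j) = diskElement b j :=
  (supportModule.desc_app_one _ _ _ (𝟙 s)).trans (map_self_apply (V := (cochains j).obj B) _ _)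

/-- The map `D_s^{k + 1} ⟶ B` which takes the generator to `b`. -/
def desc (b : ((cochains k).obj B).obj s) : persistentDisk (k + 1) s ⟶ B :=
  homOfCochains (cochainsDesc b) fun j => by
    refine cochains_hom_ext ?_
    rw [NatTrans.comp_app, NatTrans.comp_app, ConcreteCategory.comp_apply,
      ConcreteCategory.comp_apply, cochainsDesc_one]
    rcases eq_or_ne j k with rfl | hjk
    · rw [differential_one, cochainsDesc_one, diskElement_self, diskElement_succ]
    · rw [differential_one_eq_zero s hjk, differential_diskElement b hjk, map_zero]

theorem cochains_map_desc_one (b : ((cochains k).obj B).obj s) :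
    ((cochains k).map (desc b)).app s (one (k + 1) s k) = b :=
  (cochainsDesc_one b k).trans (diskElement_self b)

theorem cochains_map_eq_zero {g : persistentDisk (k + 1) s ⟶ B}
    (h : (differential B k (k + 1)).app s (((cochains k).map g).app s (one (k + 1) s k)) = 0)
    (hj : j ≠ k) : (cochains j).map g = 0 := by
  refine cochains_hom_ext ?_
  by_cases hjk : j = k + 1
  · subst hjk
    rwa [differential_cochains_map_apply, differential_one] at h
  · rw [one_eq_zero (by omega), map_zero, map_zero]

end persistentDisk

theorem intervalSphere_hom_ext {f g : intervalSphere k s t ⟶ B}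
    (h : ∀ r j, sphereSupport k s t r j →
      (f.app r).f j (QIf.one _) = (g.app r).f j (QIf.one _)) : f = g :=
  NatTrans.ext (funext fun r => HomologicalComplex.hom_ext _ _ fun j => QIf.hom_ext (h r j))

theorem sphereToDisk_comp_app_one (g : persistentDisk (k + 1) s ⟶ B) {r : ℝ≥0} (φ : s ⟶ r)
    (h : sphereSupport (k + 1) s t r j) :
    ((sphereToDisk (k + 1) s t ≫ g).app r).f j (QIf.one _) =
      ((cochains j).obj B).map φ
        (((cochains j).map g).app s (persistentDisk.one (k + 1) s j)) := by
  have hj : diskSupport (k + 1) s s j :=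
    ⟨le_rfl, k.succ_ne_zero, h.2.elim (fun h => .inl h.2) fun h => h.2.2⟩
  refine Eq.trans ?_ (NatTrans.naturality_apply ((cochains j).map g) φ _)
  refine congrArg ((g.app r).f j) ?_
  exact (QIf.map_one h).trans (QIf.map_one hj).symm

theorem sphereToDisk_comp_eq_zero_iff {g : persistentDisk (k + 1) s ⟶ B} :
    sphereToDisk (k + 1) s t ≫ g = 0 ↔
      (differential B k (k + 1)).app s
        (((cochains k).map g).app s (persistentDisk.one (k + 1) s k)) = 0 ∧
      ∀ r (φ : s ⟶ r), t ≤ (r : WithTop ℝ≥0) → ((cochains k).obj B).map φ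
        (((cochains k).map g).app s (persistentDisk.one (k + 1) s k)) = 0 := by
  refine ⟨fun h => ⟨?_, fun r φ hr => ?_⟩, fun ⟨hd, ht⟩ => intervalSphere_hom_ext fun r j hj => ?_⟩
  · have hs : sphereSupport (k + 1) s t s (k + 1) :=
      ⟨le_rfl, (lt_or_ge _ t).imp (⟨·, rfl⟩) (⟨·, k.succ_ne_zero, .inl rfl⟩)⟩
    rw [differential_cochains_map_apply, persistentDisk.differential_one,
      ← map_self_apply (𝟙 s) (((cochains (k + 1)).map g).app s _),
      ← sphereToDisk_comp_app_one g (𝟙 s) hs, h]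
    rfl
  · have hs : sphereSupport (k + 1) s t r k := ⟨leOfHom φ, .inr ⟨hr, k.succ_ne_zero, .inr rfl⟩⟩
    rw [← sphereToDisk_comp_app_one g φ hs, h]
    rfl
  · refine (sphereToDisk_comp_app_one g (homOfLE hj.1) hj).trans ?_
    by_cases hjk : j = k
    · subst hjk
      exact ht r _ (hj.2.elim (fun h => absurd h.2 j.succ_ne_self.symm) And.left)
    · rw [persistentDisk.cochains_map_eq_zero hd hjk]
      exact map_zero (((cochains j).obj B).map _).hom

end Disks

/-! ### Cell attachments -/

theorem isPushout_of_isIso_cokernel_map {C : Type*} [Category* C] [Abelian C]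
    {X₁ X₂ X₃ X₄ : C} {t : X₁ ⟶ X₂} {l : X₁ ⟶ X₃} {r : X₂ ⟶ X₄} {b : X₃ ⟶ X₄}
    (w : l ≫ b = t ≫ r) [Mono r] (h : IsIso (cokernel.map l r t b w)) : IsPushout t l r b := by
  have hP := IsPushout.of_hasPushout t l
  let u : pushout t l ⟶ X₄ := pushout.desc r b w.symm
  have hu₁ : pushout.inl t l ≫ u = r := pushout.inl_desc _ _ _
  have hu₂ : pushout.inr t l ≫ u = b := pushout.inr_desc _ _ _
  have : Mono (pushout.inl t l) := mono_of_mono_fac hu₁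
  let S₁ := ShortComplex.mk (pushout.inl t l) (cokernel.π _) (cokernel.condition _)
  let S₂ := ShortComplex.mk r (cokernel.π _) (cokernel.condition _)
  have hS₁ : S₁.ShortExact := { exact := S₁.exact_of_g_is_cokernel (cokernelIsCokernel _) }
  have hS₂ : S₂.ShortExact := { exact := S₂.exact_of_g_is_cokernel (cokernelIsCokernel _) }
  let c : cokernel (pushout.inl t l) ⟶ cokernel r :=
    cokernel.map _ _ (𝟙 _) u (by rw [hu₁, Category.id_comp])
  have hc : IsIso c := by
    have := isIso_cokernel_map_of_isPushout hP.flip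
    have hcomp : cokernel.map _ _ _ _ hP.flip.w ≫ c = cokernel.map l r t b w := by
      ext
      simp [c, ← hu₂]
    rw [← hcomp] at h
    exact IsIso.of_isIso_comp_left (cokernel.map _ _ _ _ hP.flip.w) c
  let φ : S₁ ⟶ S₂ :=
    { τ₁ := 𝟙 _
      τ₂ := u
      τ₃ := c
      comm₁₂ := by simp [S₁, S₂, hu₁]
      comm₂₃ := by simp [S₁, S₂, c] }
  have : IsIso u := ShortComplex.isIso₂_of_shortExact_of_isIso₁₃' φ hS₁ hS₂
    (inferInstanceAs (IsIso (𝟙 _))) hc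
  exact hP.of_iso (Iso.refl _) (Iso.refl _) (Iso.refl _) (asIso u) (by simp) (by simp)
    (by simp [hu₁]) (by simp [hu₂])

theorem isIso_of_isIso_cochains {A B : PCh} (f : A ⟶ B)
    (h : ∀ k, IsIso ((cochains k).map f)) : IsIso f := by
  rw [NatTrans.isIso_iff_isIso_app]
  intro r
  have : ∀ k, IsIso ((f.app r).f k) := fun k =>
    inferInstanceAs (IsIso (((cochains k).map f).app r))
  exact HomologicalComplex.Hom.isIso_of_components _

theorem mono_of_isInjective {A B : PCh} {f : A ⟶ B} (hf : IsInjective f) : Mono f := by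
  have : ∀ r, Mono (f.app r) := fun r => by
    have : ∀ k, Mono ((f.app r).f k) := fun k =>
      (ModuleCat.mono_iff_injective _).2 (hf r k)
    exact HomologicalComplex.mono_of_mono_f _ this
  exact NatTrans.mono_of_mono_app f

section CellAttachments

variable {Γ : ℕ → Type} (s : ∀ k, Γ k → ℝ≥0) (t : ∀ k, Γ k → WithTop ℝ≥0) {A B : PCh}

/-- The map along which cells are attached: the sum of the natural maps from the interval spheres
of degree `k + 1` on `[s k γ, t k γ)` to the persistent disks. -/
abbrev sphereToDiskSum :
    (∐ fun γ : Σ k, Γ k => intervalSphere (γ.1 + 1) (s γ.1 γ.2) (t γ.1 γ.2)) ⟶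
      ∐ fun γ : Σ k, Γ k => persistentDisk (γ.1 + 1) (s γ.1 γ.2) :=
  Limits.Sigma.map fun γ => sphereToDisk (γ.1 + 1) (s γ.1 γ.2) (t γ.1 γ.2)

/-- The map from a persistent disk to the cokernel of the sum of the natural maps from interval
spheres to persistent disks. -/
def diskToCokernel (γ : Σ k, Γ k) :
    persistentDisk (γ.1 + 1) (s γ.1 γ.2) ⟶ cokernel (sphereToDiskSum s t) :=
  Sigma.ι (fun γ : Σ k, Γ k => persistentDisk (γ.1 + 1) (s γ.1 γ.2)) γ ≫ cokernel.π _

/-- The class of the generator of a persistent disk in the cokernel of the sum of the natural maps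
from interval spheres to persistent disks. -/
def cellClass (k : ℕ) (γ : Γ k) :
    ((cochains k).obj (cokernel (sphereToDiskSum s t))).obj (s k γ) :=
  ((cochains k).map (diskToCokernel s t ⟨k, γ⟩)).app (s k γ)
    (persistentDisk.one (k + 1) (s k γ) k)

theorem sphereToDisk_comp_diskToCokernel (γ : Σ k, Γ k) :
    sphereToDisk (γ.1 + 1) (s γ.1 γ.2) (t γ.1 γ.2) ≫ diskToCokernel s t γ = 0 := by
  have hι : sphereToDisk (γ.1 + 1) (s γ.1 γ.2) (t γ.1 γ.2) ≫
      Sigma.ι (fun γ : Σ k, Γ k => persistentDisk (γ.1 + 1) (s γ.1 γ.2)) γ =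
        Sigma.ι (fun γ : Σ k, Γ k => intervalSphere (γ.1 + 1) (s γ.1 γ.2) (t γ.1 γ.2)) γ ≫
          sphereToDiskSum s t := by
    simp only [sphereToDiskSum, Limits.Sigma.map, Sigma.ι, ι_colimMap, Discrete.natTrans_app]
  rw [diskToCokernel, reassoc_of% hι, cokernel.condition, comp_zero]

theorem cochains_cokernel_hom_ext {k : ℕ} {V : PVec}
    {f g : (cochains k).obj (cokernel (sphereToDiskSum s t)) ⟶ V}
    (h : ∀ γ : Γ k, f.app (s k γ) (cellClass s t k γ) = g.app (s k γ) (cellClass s t k γ)) :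
    f = g := by
  rw [← cancel_epi ((cochains k).map (cokernel.π _))]
  refine Cofan.IsColimit.hom_ext (isColimitOfHasCoproductOfPreservesColimit (cochains k)
    (fun γ : Σ k, Γ k => persistentDisk (γ.1 + 1) (s γ.1 γ.2))) _ _ ?_
  rintro ⟨l, γ⟩
  change (cochains k).map (diskToCokernel s t ⟨l, γ⟩) ≫ f =
    (cochains k).map (diskToCokernel s t ⟨l, γ⟩) ≫ g
  rcases eq_or_ne k l with rfl | hkl
  · exact persistentDisk.cochains_hom_ext (h γ)
  · have hd := (sphereToDisk_comp_eq_zero_iff.1 (sphereToDisk_comp_diskToCokernel s t ⟨l, γ⟩)).1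
    rw [persistentDisk.cochains_map_eq_zero hd hkl, zero_comp, zero_comp]

variable {s t}

theorem IsIntervalDecomposition.cochains_cokernel {k : ℕ} {f : A ⟶ B}
    {b : ∀ γ : Γ k, ((cochains k).obj B).obj (s k γ)}
    (hb : IsIntervalDecomposition (s k) (t k) (cokernel ((cochains k).map f))
      fun γ => (cokernel.π ((cochains k).map f)).app (s k γ) (b γ)) :
    IsIntervalDecomposition (s k) (t k) ((cochains k).obj (cokernel f))
      fun γ => ((cochains k).map (cokernel.π f)).app (s k γ) (b γ) := by
  refine hb.of_iso (PreservesCokernel.iso (cochains k) f).symm fun γ => ?_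
  have hπ := PreservesCokernel.π_iso_hom (cochains k) f
  rw [← Iso.eq_comp_inv] at hπ
  exact (ConcreteCategory.congr_hom (congrArg (·.app (s k γ)) hπ) (b γ)).symm

theorem isIso_cokernel_map_of_isIntervalDecomposition {f : A ⟶ B}
    {b : ∀ k (γ : Γ k), ((cochains k).obj B).obj (s k γ)}
    (hb : ∀ k, IsIntervalDecomposition (s k) (t k) ((cochains k).obj (cokernel f))
      fun γ => ((cochains k).map (cokernel.π f)).app (s k γ) (b k γ))
    {φ : _ ⟶ A} (w : sphereToDiskSum s t ≫
      Sigma.desc (fun γ => persistentDisk.desc (b γ.1 γ.2)) = φ ≫ f) :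
    IsIso (cokernel.map _ f φ _ w) := by
  refine isIso_of_isIso_cochains _ fun k => (hb k).isIso (v := cellClass s t k) (fun γ => ?_)
    (fun γ r φ hr => ?_) (cochains_cokernel_hom_ext s t)
  · have hc : diskToCokernel s t ⟨k, γ⟩ ≫ cokernel.map _ f φ _ w =
        persistentDisk.desc (b k γ) ≫ cokernel.π f := by
      simp [diskToCokernel]
    have hcapp := congrArg (fun g => ((cochains k).map g).app (s k γ)) hc
    exact (ConcreteCategory.congr_hom hcapp _).trans
      (congrArg _ (persistentDisk.cochains_map_desc_one (b k γ)))
  · exact (sphereToDisk_comp_eq_zero_iff.1 (sphereToDisk_comp_diskToCokernel s t ⟨k, γ⟩)).2 r φ hr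

theorem isCellAttachment_of_isIntervalDecomposition {f : A ⟶ B} [Mono f]
    {b : ∀ k (γ : Γ k), ((cochains k).obj B).obj (s k γ)}
    (hd : ∀ k γ, ((cochains (k + 1)).map (cokernel.π f)).app (s k γ)
      ((differential B k (k + 1)).app (s k γ) (b k γ)) = 0)
    (hb : ∀ k, IsIntervalDecomposition (s k) (t k) (cokernel ((cochains k).map f))
      fun γ => (cokernel.π ((cochains k).map f)).app (s k γ) (b k γ)) :
    IsCellAttachment s t f b := by
  have hb' k := (hb k).cochains_cokernel
  have hzero : ∀ γ : Σ k, Γ k, (sphereToDisk (γ.1 + 1) (s γ.1 γ.2) (t γ.1 γ.2) ≫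
      persistentDisk.desc (b γ.1 γ.2)) ≫ cokernel.π f = 0 := fun ⟨k, γ⟩ => by
    have hgen : ((cochains k).map (persistentDisk.desc (b k γ) ≫ cokernel.π f)).app (s k γ)
        (persistentDisk.one (k + 1) (s k γ) k) =
          ((cochains k).map (cokernel.π f)).app (s k γ) (b k γ) :=
      congrArg _ (persistentDisk.cochains_map_desc_one (b k γ))
    rw [Category.assoc, sphereToDisk_comp_eq_zero_iff, hgen]
    exact ⟨(differential_cochains_map_apply _ _ _ _).trans (hd k γ),
      fun r φ hr => (hb' k).map_eq_zero γ φ hr⟩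
  have w : sphereToDiskSum s t ≫ Sigma.desc (fun γ => persistentDisk.desc (b γ.1 γ.2)) =
      Sigma.desc (fun γ => Abelian.monoLift f _ (hzero γ)) ≫ f := by
    ext γ : 1
    simp [sphereToDiskSum]
  refine ⟨_, _, isPushout_of_isIso_cokernel_map w
    (isIso_cokernel_map_of_isIntervalDecomposition hb' w), fun k γ => ?_⟩
  rw [Sigma.ι_desc]
  exact persistentDisk.cochains_map_desc_one (b k γ)

end CellAttachments

/-! ### Cokernels of maps of persistence modules -/

section Cokernels

universe w

variable {J : Type*} [Category* J] {R : Type*} [Ring R]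

theorem cokernel_π_app_eq_zero_iff {V V' : J ⥤ ModuleCat.{w} R} (f : V ⟶ V') {r : J}
    (x : V'.obj r) : (cokernel.π f).app r x = 0 ↔ ∃ y, f.app r y = x := by
  have hS : (ShortComplex.mk f (cokernel.π f) (cokernel.condition f)).Exact :=
    ShortComplex.exact_of_g_is_cokernel _ (cokernelIsCokernel f)
  refine ⟨(ShortComplex.moduleCat_exact_iff _).1 (hS.map ((evaluation _ _).obj r)) x, ?_⟩
  rintro ⟨y, rfl⟩
  exact ConcreteCategory.congr_hom (congrArg (·.app r) (cokernel.condition f)) y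

theorem cokernel_π_app_surjective {V V' : J ⥤ ModuleCat.{w} R} (f : V ⟶ V') (r : J) :
    Function.Surjective ((cokernel.π f).app r) :=
  (ModuleCat.epi_iff_surjective _).1 inferInstance

theorem isIso_cokernel_obj_map {V V' : J ⥤ ModuleCat.{w} R} (f : V ⟶ V') {a b : J} (φ : a ⟶ b)
    [Epi (V.map φ)] [IsIso (V'.map φ)] : IsIso ((cokernel f).map φ) := by
  have hepi : Epi ((cokernel f).map φ) :=
    epi_of_epi_fac ((cokernel.π f).naturality φ).symm
  have hmono : Mono ((cokernel f).map φ) := by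
    refine (ModuleCat.mono_iff_injective _).2 ((injective_iff_map_eq_zero _).2 fun x hx => ?_)
    obtain ⟨x, rfl⟩ := cokernel_π_app_surjective f a x
    rw [← NatTrans.naturality_apply, cokernel_π_app_eq_zero_iff] at hx
    obtain ⟨y, hy⟩ := hx
    obtain ⟨y, rfl⟩ := (ModuleCat.epi_iff_surjective (V.map φ)).1 inferInstance y
    rw [NatTrans.naturality_apply] at hy
    exact (cokernel_π_app_eq_zero_iff f x).2
      ⟨y, (ModuleCat.mono_iff_injective (V'.map φ)).1 inferInstance hy⟩
  exact isIso_of_mono_of_epi _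

theorem cokernel_map_app_π_app {V₁ V₂ V₃ V₄ : J ⥤ ModuleCat.{w} R} {f : V₁ ⟶ V₂} {g : V₃ ⟶ V₄}
    {p : V₁ ⟶ V₃} {q : V₂ ⟶ V₄} (w : f ≫ q = p ≫ g) {r : J} (y : V₂.obj r) :
    (cokernel.map f g p q w).app r ((cokernel.π f).app r y) =
      (cokernel.π g).app r (q.app r y) :=
  ConcreteCategory.congr_hom (congrArg (·.app r) (cokernel.π_desc f (q ≫ cokernel.π g) _)) y

theorem isIso_cokernel_map {V₁ V₂ V₃ V₄ : J ⥤ ModuleCat.{w} R} {f : V₁ ⟶ V₂} {g : V₃ ⟶ V₄}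
    {p : V₁ ⟶ V₃} {q : V₂ ⟶ V₄} (w : f ≫ q = p ≫ g)
    (hpre : ∀ r x y, g.app r x = q.app r y → ∃ z, f.app r z = y)
    (hadd : ∀ r (u : V₄.obj r), ∃ x y, g.app r x + q.app r y = u) :
    IsIso (cokernel.map f g p q w) := by
  rw [NatTrans.isIso_iff_isIso_app]
  refine fun r => (ConcreteCategory.isIso_iff_bijective _).2
    ⟨(injective_iff_map_eq_zero _).2 fun y hy => ?_, fun u => ?_⟩
  · obtain ⟨y, rfl⟩ := cokernel_π_app_surjective f r y
    rw [cokernel_map_app_π_app, cokernel_π_app_eq_zero_iff] at hy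
    obtain ⟨x, hx⟩ := hy
    exact (cokernel_π_app_eq_zero_iff f y).2 (hpre r x y hx)
  · obtain ⟨u, rfl⟩ := cokernel_π_app_surjective g r u
    obtain ⟨x, y, rfl⟩ := hadd r u
    refine ⟨(cokernel.π f).app r y, ?_⟩
    rw [cokernel_map_app_π_app, map_add, (cokernel_π_app_eq_zero_iff g _).2 ⟨x, rfl⟩, zero_add]

end Cokernels

/-! ### Cocycles -/

section Cocycles

/-- The inclusion of the cocycles of a persistent complex into its cochains. -/
def cocyclesι (Y : PCh) (k : ℕ) : (cocycles k).obj Y ⟶ (cochains k).obj Y where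
  app r := (Y.obj r).iCycles k
  naturality _ _ φ := HomologicalComplex.cyclesMap_i (Y.map φ) k

variable {X Y : PCh} {k : ℕ}

instance : Mono (cocyclesι Y k) :=
  have : ∀ r, Mono ((cocyclesι Y k).app r) := fun r => inferInstanceAs (Mono ((Y.obj r).iCycles k))
  NatTrans.mono_of_mono_app _

theorem cocyclesι_naturality (i : X ⟶ Y) (k : ℕ) :
    (cocycles k).map i ≫ cocyclesι Y k = cocyclesι X k ≫ (cochains k).map i :=
  NatTrans.ext (funext fun r => HomologicalComplex.cyclesMap_i (i.app r) k)

theorem exists_cocyclesι_eq_iff {r : ℝ≥0} {y : ((cochains k).obj Y).obj r} :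
    (∃ z, (cocyclesι Y k).app r z = y) ↔ (differential Y k (k + 1)).app r y = 0 := by
  have hS : (ShortComplex.mk _ _ ((Y.obj r).iCycles_d k (k + 1))).Exact :=
    ShortComplex.exact_of_f_is_kernel _
      ((Y.obj r).cyclesIsKernel k (k + 1) (CochainComplex.next ℕ k))
  refine ⟨?_, (ShortComplex.moduleCat_exact_iff _).1 hS y⟩
  rintro ⟨z, rfl⟩
  exact ConcreteCategory.congr_hom ((Y.obj r).iCycles_d k (k + 1)) z

theorem isIso_cocycles_map {a b : ℝ≥0} (φ : a ⟶ b) [IsIso (((cochains k).obj Y).map φ)]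
    [Mono (((cochains (k + 1)).obj Y).map φ)] : IsIso (((cocycles k).obj Y).map φ) := by
  refine ShortComplex.isIso_cyclesMap_of_isIso_of_mono'
    ((HomologicalComplex.shortComplexFunctor _ _ k).map (Y.map φ)) ‹_› ?_
  change Mono ((Y.map φ).f _)
  rw [CochainComplex.next]
  assumption

end Cocycles

/-! ### Subcomplexes -/

section Subcomplexes

variable {X Y : PCh} (S : ∀ r k, Submodule ℚ ((Y.obj r).X k))

/-- The subcomplex of `Y` consisting of the submodules `S r k`. -/
def subcomplex (hd : ∀ r i j, S r i ≤ (S r j).comap ((Y.obj r).d i j).hom)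
    (hm : ∀ a b (φ : a ⟶ b) k, S a k ≤ (S b k).comap ((Y.map φ).f k).hom) : PCh where
  obj r :=
    { X k := ModuleCat.of ℚ (S r k)
      d i j := ModuleCat.ofHom (((Y.obj r).d i j).hom.restrict (hd r i j))
      shape i j h := by
        ext x
        exact ConcreteCategory.congr_hom ((Y.obj r).shape i j h) x.1
      d_comp_d' i j l _ _ := by
        ext x
        exact ConcreteCategory.congr_hom ((Y.obj r).d_comp_d i j l) x.1 }
  map {a b} φ :=
    { f k := ModuleCat.ofHom (((Y.map φ).f k).hom.restrict (hm a b φ k))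
      comm' i j _ := by
        ext x
        exact ConcreteCategory.congr_hom ((Y.map φ).comm i j) x.1 }
  map_id r := by
    ext k x
    exact ConcreteCategory.congr_hom (((cochains k).obj Y).map_id r) x.1
  map_comp f g := by
    ext k x
    exact ConcreteCategory.congr_hom (((cochains k).obj Y).map_comp f g) x.1

variable {S} {hd : ∀ r i j, S r i ≤ (S r j).comap ((Y.obj r).d i j).hom}
  {hm : ∀ a b (φ : a ⟶ b) k, S a k ≤ (S b k).comap ((Y.map φ).f k).hom}

/-- The inclusion of a subcomplex. -/
def subcomplex.ι : subcomplex S hd hm ⟶ Y where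
  app r :=
    { f k := ModuleCat.ofHom (S r k).subtype
      comm' _ _ _ := rfl }
  naturality _ _ _ := rfl

/-- The map into a subcomplex given by a map of persistent complexes whose values lie in the
subcomplex. -/
def subcomplex.lift (i : X ⟶ Y) (hi : ∀ r k x, (i.app r).f k x ∈ S r k) :
    X ⟶ subcomplex S hd hm where
  app r :=
    { f k := ModuleCat.ofHom (((i.app r).f k).hom.codRestrict (S r k) (hi r k))
      comm' k l _ := by
        ext x
        exact Subtype.ext (ConcreteCategory.congr_hom ((i.app r).comm k l) x) }
  naturality a b φ := by
    ext k x
    exact Subtype.ext (NatTrans.naturality_apply ((cochains k).map i) φ x)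

end Subcomplexes

/-! ### The subcomplex `i(X) + ZY` -/

theorem exists_isImageAddCocycles {X Y : PCh} (i : X ⟶ Y) :
    ∃ (W : PCh) (a : X ⟶ W) (j : W ⟶ Y), a ≫ j = i ∧ IsImageAddCocycles i j := by
  let S : ∀ r k, Submodule ℚ ((Y.obj r).X k) := fun r k =>
    LinearMap.range ((i.app r).f k).hom ⊔ LinearMap.ker ((Y.obj r).d k (k + 1)).hom
  have hd : ∀ r k l, S r k ≤ (S r l).comap ((Y.obj r).d k l).hom := by
    refine fun r k l => sup_le ?_ fun z (hz : (Y.obj r).d k (k + 1) z = 0) => ?_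
    · rintro _ ⟨x, rfl⟩
      exact Submodule.mem_sup_left
        ⟨(X.obj r).d k l x, (differential_cochains_map_apply i k l x).symm⟩
    · have hzl : (Y.obj r).d k l z = 0 := by
        by_cases hkl : k + 1 = l
        · subst hkl
          exact hz
        · exact ConcreteCategory.congr_hom ((Y.obj r).shape k l hkl) z
      exact (Submodule.mem_comap ..).2 (hzl.symm ▸ Submodule.zero_mem (S r l))
  have hm : ∀ a b (φ : a ⟶ b) k, S a k ≤ (S b k).comap ((Y.map φ).f k).hom := by
    refine fun a b φ k => sup_le ?_ fun z (hz : (differential Y k (k + 1)).app a z = 0) => ?_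
    · rintro _ ⟨x, rfl⟩
      exact Submodule.mem_sup_left
        ⟨(X.map φ).f k x, NatTrans.naturality_apply ((cochains k).map i) φ x⟩
    · refine Submodule.mem_sup_right
        ((NatTrans.naturality_apply (differential Y k (k + 1)) φ z).trans ?_)
      exact (congrArg _ hz).trans (map_zero (((cochains (k + 1)).obj Y).map φ).hom)
  exact ⟨subcomplex S hd hm, subcomplex.lift i fun r k x => Submodule.mem_sup_left ⟨x, rfl⟩,
    subcomplex.ι, rfl, fun r k => Subtype.val_injective, fun r k => Submodule.range_subtype (S r k)⟩

namespace IsImageAddCocycles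

variable {X W Y : PCh} {i : X ⟶ Y} {j : W ⟶ Y}

theorem mono_cochains_map (h : IsImageAddCocycles i j) (k : ℕ) : Mono ((cochains k).map j) :=
  have : Mono j := mono_of_isInjective h.1
  inferInstance

theorem exists_cochains_map_eq_of_differential_eq_zero (h : IsImageAddCocycles i j) {r : ℝ≥0}
    {k : ℕ} {y : ((cochains k).obj Y).obj r} (hy : (differential Y k (k + 1)).app r y = 0) :
    ∃ w, ((cochains k).map j).app r w = y :=
  (h.2 r k).ge (Submodule.mem_sup_right hy)

theorem cocyclesι_comp_cokernel_π (h : IsImageAddCocycles i j) (k : ℕ) :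
    cocyclesι Y k ≫ cokernel.π ((cochains k).map j) = 0 := by
  ext r z
  exact (cokernel_π_app_eq_zero_iff _ _).2
    (h.exists_cochains_map_eq_of_differential_eq_zero (exists_cocyclesι_eq_iff.1 ⟨z, rfl⟩))

/-- The inclusion of the cocycles of `Y` into `W = i(X) + ZY`. -/
def cocyclesLift (h : IsImageAddCocycles i j) (k : ℕ) :
    (cocycles k).obj Y ⟶ (cochains k).obj W :=
  have := h.mono_cochains_map k
  Abelian.monoLift _ _ (h.cocyclesι_comp_cokernel_π k)

theorem cocyclesLift_comp (h : IsImageAddCocycles i j) (k : ℕ) :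
    h.cocyclesLift k ≫ (cochains k).map j = cocyclesι Y k :=
  have := h.mono_cochains_map k
  Abelian.monoLift_comp _ _ (h.cocyclesι_comp_cokernel_π k)

theorem cochains_map_cocyclesLift (h : IsImageAddCocycles i j) (k : ℕ) {r : ℝ≥0}
    (z : ((cocycles k).obj Y).obj r) :
    ((cochains k).map j).app r ((h.cocyclesLift k).app r z) = (cocyclesι Y k).app r z :=
  ConcreteCategory.congr_hom (congrArg (·.app r) (h.cocyclesLift_comp k)) z

theorem differential_cocyclesLift (h : IsImageAddCocycles i j) (k : ℕ) {r : ℝ≥0}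
    (z : ((cocycles k).obj Y).obj r) :
    (differential W k (k + 1)).app r ((h.cocyclesLift k).app r z) = 0 := by
  refine h.1 r (k + 1) ((differential_cochains_map_apply j k (k + 1) _).symm.trans ?_)
  rw [cochains_map_cocyclesLift, exists_cocyclesι_eq_iff.1 ⟨z, rfl⟩]
  exact (map_zero (((cochains (k + 1)).map j).app r).hom).symm

variable {a : X ⟶ W}

theorem cocycles_map_comp_cocyclesLift (h : IsImageAddCocycles (a ≫ j) j) (k : ℕ) :
    (cocycles k).map (a ≫ j) ≫ h.cocyclesLift k = cocyclesι X k ≫ (cochains k).map a := by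
  have := h.mono_cochains_map k
  rw [← cancel_mono ((cochains k).map j), Category.assoc, cocyclesLift_comp,
    cocyclesι_naturality, Category.assoc, Functor.map_comp]

theorem exists_add_eq (h : IsImageAddCocycles (a ≫ j) j) {r : ℝ≥0} {k : ℕ}
    (w : ((cochains k).obj W).obj r) :
    ∃ x z, ((cochains k).map a).app r x + (h.cocyclesLift k).app r z = w := by
  obtain ⟨_, ⟨x, rfl⟩, y, hy, hxy⟩ := Submodule.mem_sup.1 ((h.2 r k).le ⟨w, rfl⟩)
  obtain ⟨z, rfl⟩ := exists_cocyclesι_eq_iff.2 hy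
  have hinj : Function.Injective (((cochains k).map j).app r) := h.1 r k
  refine ⟨x, z, hinj ?_⟩
  rw [map_add, cochains_map_cocyclesLift]
  exact hxy

theorem isIso_cochains_map (h : IsImageAddCocycles (a ≫ j) j) {k : ℕ} {r s : ℝ≥0} (φ : r ⟶ s)
    [Epi (((cochains k).obj X).map φ)] [Epi (((cocycles k).obj Y).map φ)]
    [Mono (((cochains k).obj Y).map φ)] : IsIso (((cochains k).obj W).map φ) := by
  have := h.mono_cochains_map k
  have hmono : Mono (((cochains k).obj W).map φ) :=
    mono_of_mono_fac (((cochains k).map j).naturality φ)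
  have hepi : Epi (((cochains k).obj W).map φ) := by
    refine (ModuleCat.epi_iff_surjective _).2 fun w => ?_
    obtain ⟨x, z, rfl⟩ := h.exists_add_eq w
    obtain ⟨x, rfl⟩ := (ModuleCat.epi_iff_surjective (((cochains k).obj X).map φ)).1 ‹_› x
    obtain ⟨z, rfl⟩ := (ModuleCat.epi_iff_surjective (((cocycles k).obj Y).map φ)).1 ‹_› z
    refine ⟨((cochains k).map a).app r x + (h.cocyclesLift k).app r z, ?_⟩
    rw [map_add, ← NatTrans.naturality_apply, ← NatTrans.naturality_apply]
  exact isIso_of_mono_of_epi _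

theorem isIso_cokernel_map_cocyclesLift (h : IsImageAddCocycles (a ≫ j) j)
    (hi : IsInjective (a ≫ j)) (k : ℕ) :
    IsIso (cokernel.map _ _ _ _ (h.cocycles_map_comp_cocyclesLift k)) := by
  refine isIso_cokernel_map _ (fun r x z hxz => ?_) fun r w => h.exists_add_eq w
  have hix : ((cochains k).map (a ≫ j)).app r x = (cocyclesι Y k).app r z :=
    (congrArg (((cochains k).map j).app r) hxz).trans (h.cochains_map_cocyclesLift k z)
  have hdx : (differential X k (k + 1)).app r x = 0 := by
    refine hi r (k + 1) ((differential_cochains_map_apply (a ≫ j) k (k + 1) x).symm.trans ?_)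
    rw [hix, exists_cocyclesι_eq_iff.1 ⟨z, rfl⟩]
    exact (map_zero (((cochains (k + 1)).map (a ≫ j)).app r).hom).symm
  obtain ⟨x, rfl⟩ := exists_cocyclesι_eq_iff.2 hdx
  have hnat := congrArg (·.app r) (cocyclesι_naturality (a ≫ j) k)
  exact ⟨x, (ModuleCat.mono_iff_injective ((cocyclesι Y k).app r)).1 inferInstance
    ((ConcreteCategory.congr_hom hnat x).trans hix)⟩

end IsImageAddCocycles

/-! ### Tameness of the quotients -/

theorem IsTame.of_isIso_map {C D ι : Type*} [Category* C] [Category* D] [Finite ι]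
    {X : Persistent C} {F : ι → Persistent D} (hF : ∀ i, IsTame (F i))
    (h : ∀ ⦃a b : ℝ≥0⦄ (φ : a ⟶ b), (∀ i, IsIso ((F i).map φ)) → IsIso (X.map φ)) : IsTame X := by
  classical
  have := Fintype.ofFinite ι
  choose T hT using fun i => isTame_iff.1 (hF i)
  refine isTame_iff.2 ⟨Finset.univ.biUnion T, fun a b φ hφ => h φ fun i => ?_⟩
  exact (hT i).mono (Finset.subset_biUnion_of_mem T (Finset.mem_univ i)) φ hφ

theorem IsTame.cokernel {V V' : PVec} (hV : IsTame V) (hV' : IsTame V') (f : V ⟶ V') :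
    IsTame (cokernel f) :=
  .of_isIso_map (F := ![V, V']) (by simp [Fin.forall_fin_succ, hV, hV']) fun a b φ h => by
    have : IsIso (V.map φ) := h 0
    have : IsIso (V'.map φ) := h 1
    exact isIso_cokernel_obj_map f φ

theorem isTame_cocycles {Y : PCh} (hY : ∀ k, IsTame ((cochains k).obj Y)) (k : ℕ) :
    IsTame ((cocycles k).obj Y) :=
  .of_isIso_map (F := ![(cochains k).obj Y, (cochains (k + 1)).obj Y])
    (by simp only [Fin.forall_fin_two]; exact ⟨hY k, hY (k + 1)⟩) fun a b φ h => by
    have : IsIso (((cochains k).obj Y).map φ) := h 0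
    have : IsIso (((cochains (k + 1)).obj Y).map φ) := h 1
    exact isIso_cocycles_map φ

theorem IsImageAddCocycles.isTame_cochains {X W Y : PCh} {a : X ⟶ W} {j : W ⟶ Y}
    (h : IsImageAddCocycles (a ≫ j) j) (hX : ∀ k, IsTame ((cochains k).obj X))
    (hY : ∀ k, IsTame ((cochains k).obj Y)) (k : ℕ) : IsTame ((cochains k).obj W) :=
  .of_isIso_map (F := ![(cochains k).obj X, (cocycles k).obj Y, (cochains k).obj Y])
    (by simp only [Fin.forall_fin_succ]; exact ⟨hX k, isTame_cocycles hY k, hY k, nofun⟩)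
    fun r s φ hφ => by
    have : IsIso (((cochains k).obj X).map φ) := hφ 0
    have : IsIso (((cocycles k).obj Y).map φ) := hφ 1
    have : IsIso (((cochains k).obj Y).map φ) := hφ 2
    exact h.isIso_cochains_map φ

/-! ### Cofibrations -/

theorem IsCellAttachment.cofibration {Γ : ℕ → Type} {s : ∀ k, Γ k → ℝ≥0}
    {t : ∀ k, Γ k → WithTop ℝ≥0} {A B : PCh} {f : A ⟶ B}
    {b : ∀ k (γ : Γ k), ((cochains k).obj B).obj (s k γ)} (h : IsCellAttachment s t f b)
    (hst : ∀ k γ, (s k γ : WithTop ℝ≥0) < t k γ) : Cofibration f := by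
  obtain ⟨φ, ψ, hpush, -⟩ := h
  rw [cofibration_iff]
  refine MorphismProperty.of_isPushout (P := generatingCofibrations.rlp.llp) hpush
    (MorphismProperty.colimMap _ ?_)
  rintro ⟨γ⟩
  exact MorphismProperty.le_llp_rlp _ _ (.sphereToDisk _ _ _ (hst _ _))

theorem IsTwoStepCellAttachment.cofibration {X Y : PCh} {i : X ⟶ Y}
    (h : IsTwoStepCellAttachment i) : Cofibration i := by
  obtain ⟨W, a, j, rfl, -, ⟨Γ, s, t, z, w, -, hz, ha⟩, Δ, s', t', y, hy, hj⟩ := h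
  have ha := (cofibration_iff _).1 (ha.cofibration fun k => (hz k).1)
  have hj := (cofibration_iff _).1 (hj.cofibration fun k => (hy k).1)
  exact (cofibration_iff _).2
    (MorphismProperty.comp_mem generatingCofibrations.rlp.llp _ _ ha hj)

section TwoSteps

variable {X W Y : PCh} {a : X ⟶ W} {j : W ⟶ Y}

theorem IsImageAddCocycles.isCellAttachment_cocyclesLift (h : IsImageAddCocycles (a ≫ j) j)
    (hi : IsInjective (a ≫ j)) {Γ : ℕ → Type} {s : ∀ k, Γ k → ℝ≥0} {t : ∀ k, Γ k → WithTop ℝ≥0}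
    {z : ∀ k (γ : Γ k), ((cocycles k).obj Y).obj (s k γ)}
    (hz : ∀ k, IsIntervalDecomposition (s k) (t k) (cokernel ((cocycles k).map (a ≫ j)))
      fun γ => (cokernel.π ((cocycles k).map (a ≫ j))).app (s k γ) (z k γ)) :
    IsCellAttachment s t a fun k γ => (h.cocyclesLift k).app (s k γ) (z k γ) := by
  have := mono_of_isInjective hi
  have : Mono a := mono_of_mono a j
  refine isCellAttachment_of_isIntervalDecomposition (fun k γ => ?_) fun k => ?_
  · rw [h.differential_cocyclesLift, map_zero]
  · have := h.isIso_cokernel_map_cocyclesLift hi k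
    exact (hz k).of_iso (asIso (cokernel.map _ _ _ _ (h.cocycles_map_comp_cocyclesLift k)))
      fun γ => cokernel_map_app_π_app (h.cocycles_map_comp_cocyclesLift k) (z k γ)

theorem IsImageAddCocycles.isCellAttachment {i : X ⟶ Y}
    (h : IsImageAddCocycles i j) {Δ : ℕ → Type} {s : ∀ k, Δ k → ℝ≥0}
    {t : ∀ k, Δ k → WithTop ℝ≥0} {y : ∀ k (δ : Δ k), ((cochains k).obj Y).obj (s k δ)}
    (hy : ∀ k, IsIntervalDecomposition (s k) (t k) (cokernel ((cochains k).map j))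
      fun δ => (cokernel.π ((cochains k).map j)).app (s k δ) (y k δ)) :
    IsCellAttachment s t j y := by
  have := mono_of_isInjective h.1
  refine isCellAttachment_of_isIntervalDecomposition (fun k δ => ?_) hy
  obtain ⟨w, hw⟩ := h.exists_cochains_map_eq_of_differential_eq_zero
    (differential_differential_apply k (k + 1) (k + 2) (y k δ))
  rw [← hw]
  exact ConcreteCategory.congr_hom
    (congrArg (fun g => ((cochains (k + 1)).map g).app (s k δ)) (cokernel.condition j)) w

end TwoSteps

theorem isTwoStepCellAttachment {X Y : PCh} (i : X ⟶ Y) (hX : ∀ k, IsTame ((cochains k).obj X))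
    (hY : ∀ k, IsTame ((cochains k).obj Y)) (hi : IsInjective i) : IsTwoStepCellAttachment i := by
  obtain ⟨W, a, j, rfl, hj⟩ := exists_isImageAddCocycles i
  choose Γ s t z hz using fun k => ((isTame_cocycles hX k).cokernel (isTame_cocycles hY k)
    ((cocycles k).map (a ≫ j))).exists_isIntervalDecomposition_of_epi (cokernel.π _)
  choose Δ s' t' y hy using fun k => ((hj.isTame_cochains hX hY k).cokernel (hY k)
    ((cochains k).map j)).exists_isIntervalDecomposition_of_epi (cokernel.π _)
  exact ⟨W, a, j, rfl, hj,
    ⟨Γ, s, t, z, _, fun k γ => hj.cochains_map_cocyclesLift k (z k γ), hz,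
      hj.isCellAttachment_cocyclesLift hi hz⟩,
    ⟨Δ, s', t', y, hy, hj.isCellAttachment hy⟩⟩

theorem isTame_of_isZero_obj {C : Type*} [Category* C] {X : Persistent C}
    (hX : ∀ r, IsZero (X.obj r)) : IsTame X :=
  isTame_iff.2 ⟨∅, fun a b _ _ =>
    ⟨(hX b).to_ _, (hX a).eq_of_src _ _, (hX b).eq_of_src _ _⟩⟩

theorem isZero_cochains_initial_obj (k : ℕ) (r : ℝ≥0) :
    IsZero (((cochains k).obj (⊥_ PCh)).obj r) :=
  have h : IsZero (⊥_ PCh) :=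
    (isZero_zero _).of_iso (initialIsInitial.uniqueUpToIso (isZero_zero _).isInitial)
  (Functor.isZero_iff _).1 ((cochains k).map_isZero h) r

theorem isInjective_initial_to (X : PCh) : IsInjective (initial.to X) := fun r k =>
  have : Subsingleton (((cochains k).obj (⊥_ PCh)).obj r) :=
    ModuleCat.isZero_iff_subsingleton.1 (isZero_cochains_initial_obj k r)
  Function.injective_of_subsingleton (((cochains k).map (initial.to X)).app r)

end PersistentComplex

end

theorem mainTheorem4_general :
    (∀ (X Y : PersistentComplex.PCh) (i : X ⟶ Y),
      (∀ k, PersistentComplex.IsTame ((PersistentComplex.cochains k).obj X)) →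
      (∀ k, PersistentComplex.IsTame ((PersistentComplex.cochains k).obj Y)) →
      PersistentComplex.IsInjective i →
      Cofibration i ∧ PersistentComplex.IsTwoStepCellAttachment i) ∧
    (∀ X : PersistentComplex.PCh,
      (∀ k, PersistentComplex.IsTame ((PersistentComplex.cochains k).obj X)) → IsCofibrant X) := by
  have hcell := @PersistentComplex.isTwoStepCellAttachment
  refine ⟨fun X Y i hX hY hi => ⟨(hcell i hX hY hi).cofibration, hcell i hX hY hi⟩,
    fun X hX => (hcell _ (fun k => ?_) hX (PersistentComplex.isInjective_initial_to X)).cofibration⟩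
  exact PersistentComplex.isTame_of_isZero_obj (PersistentComplex.isZero_cochains_initial_obj k)

theorem mainTheorem4 :
    (∀ (X Y : PersistentComplex.PCh) (i : X ⟶ Y),
      PersistentComplex.IsTame X → PersistentComplex.IsTame Y →
      PersistentComplex.IsInjective i →
      Cofibration i ∧ PersistentComplex.IsTwoStepCellAttachment i) ∧
    (∀ X : PersistentComplex.PCh, PersistentComplex.IsTame X → IsCofibrant X) :=
  ⟨fun X Y i hX hY => mainTheorem4_general.1 X Y i (fun _ => hX.comp _) fun _ => hY.comp _,
    fun X hX => mainTheorem4_general.2 X fun _ => hX.comp _⟩
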